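/- Let $n\ge 1$ be an integer, let $\mathbb C\{\boldsymbol x\}=\mathbb C\{x_1,\dots,x_n\}$ be the $\mathbb C$-algebra of power series that converge absolutely in a neighbourhood of the origin, and let $w_1,\dots,w_n$ be positive integers. The weight of a monomial $x_1^{i_1}\cdots x_n^{i_n}$ is $w_1i_1+\dots+w_ni_n$, and the weight $\operatorname{wt} g$ of $g\in\mathbb C\{\boldsymbol x\}$ is the least weight of a monomial with non-zero coefficient in $g$, with $\operatorname{wt} 0=\infty$. Let $0\ne f\in\mathbb C\{\boldsymbol x\}$ and let $f_0$ be its quasihomogeneous part of least weight, that is, the sum of all terms of $f$ of weight $\operatorname{wt} f$. Suppose that $f_0$ is one of the following polynomials: - $A_k$: $x_1^{k+1}+x_2^2+\dots+x_n^2$, where $k\ge 1$ (and $n\ge 1$); - $D_k$: $x_1(x_2^2+x_1^{k-2})+x_3^2+\dots+x_n^2$, where $k\ge 4$ and $n\ge 2$; - $E_6$: $x_1^3+x_2^4+x_3^2+\dots+x_n^2$, where $n\ge 2$; - $E_7$: $x_1(x_1^2+x_2^3)+x_3^2+\dots+x_n^2$, where $n\ge 2$; - $E_8$: $x_1^3+x_2^5+x_3^2+\dots+x_n^2$,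 where $n\ge 2$. Then there is an automorphism $\Psi$ of the $\mathbb C$-algebra $\mathbb C\{\boldsymbol x\}$ that is weight-respecting, meaning that $\operatorname{wt}\Psi(x_i)\ge w_i$ and $\operatorname{wt}\Psi^{-1}(x_i)\ge w_i$ for all $i$, such that $\Psi(f)=f_0$. -/

import Mathlib

/-- The power series `f = ∑ a_d x^d` in `x_1, …, x_n` over `ℂ` converges absolutely in a
neighbourhood of the origin, i.e. `∑ |a_d| r^{|d|} < ∞` for some `r > 0` (absolute convergence
on the closed polydisc of radius `r`). -/
def IsConvergentSeries {n : ℕ} (f : MvPowerSeries (Fin n) ℂ) : Prop :=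
  ∃ r : ℝ, 0 < r ∧ Summable fun d : Fin n →₀ ℕ => ‖MvPowerSeries.coeff d f‖ * r ^ d.degree

theorem IsConvergentSeries.summable_of_le {n : ℕ} {f : MvPowerSeries (Fin n) ℂ} {r s : ℝ}
    (hf : Summable fun d : Fin n →₀ ℕ => ‖MvPowerSeries.coeff d f‖ * r ^ d.degree)
    (hs : 0 < s) (hsr : s ≤ r) :
    Summable fun d : Fin n →₀ ℕ => ‖MvPowerSeries.coeff d f‖ * s ^ d.degree := by
  refine Summable.of_nonneg_of_le (fun d => by positivity) (fun d => ?_) hf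
  gcongr

theorem IsConvergentSeries.add {n : ℕ} {f g : MvPowerSeries (Fin n) ℂ}
    (hf : IsConvergentSeries f) (hg : IsConvergentSeries g) : IsConvergentSeries (f + g) := by
  obtain ⟨r, hr, hf⟩ := hf
  obtain ⟨s, hs, hg⟩ := hg
  have ht : 0 < min r s := lt_min hr hs
  refine ⟨min r s, ht, ?_⟩
  refine Summable.of_nonneg_of_le (fun d => by positivity) (fun d => ?_)
    ((IsConvergentSeries.summable_of_le hf ht (min_le_left _ _)).add
      (IsConvergentSeries.summable_of_le hg ht (min_le_right _ _)))
  rw [map_add, ← add_mul]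
  exact mul_le_mul_of_nonneg_right (norm_add_le _ _) (by positivity)

theorem IsConvergentSeries.summable_antidiagonal {n : ℕ} {a b : (Fin n →₀ ℕ) → ℝ}
    (ha : Summable a) (hb : Summable b) (ha₀ : 0 ≤ a) (hb₀ : 0 ≤ b) :
    Summable fun d : Fin n →₀ ℕ => ∑ p ∈ Finset.HasAntidiagonal.antidiagonal d, a p.1 * b p.2 :=
  summable_sum_mul_antidiagonal_of_summable_mul (Summable.mul_of_nonneg ha hb ha₀ hb₀)

theorem IsConvergentSeries.norm_coeff_mul_le {n : ℕ} (f g : MvPowerSeries (Fin n) ℂ) {t : ℝ}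
    (ht : 0 < t) (d : Fin n →₀ ℕ) :
    ‖MvPowerSeries.coeff d (f * g)‖ * t ^ d.degree ≤
      ∑ p ∈ Finset.HasAntidiagonal.antidiagonal d, (‖MvPowerSeries.coeff p.1 f‖ * t ^ p.1.degree) *
        (‖MvPowerSeries.coeff p.2 g‖ * t ^ p.2.degree) := by
  have hsum : ‖MvPowerSeries.coeff d (f * g)‖ ≤ ∑ p ∈ Finset.HasAntidiagonal.antidiagonal d,
      ‖MvPowerSeries.coeff p.1 f * MvPowerSeries.coeff p.2 g‖ := by
    rw [MvPowerSeries.coeff_mul]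
    exact norm_sum_le _ _
  refine (mul_le_mul_of_nonneg_right hsum (pow_nonneg ht.le _)).trans ?_
  rw [Finset.sum_mul]
  refine Finset.sum_le_sum fun p hp => le_of_eq ?_
  have hd : d.degree = p.1.degree + p.2.degree := by
    rw [← Finset.HasAntidiagonal.mem_antidiagonal.mp hp, map_add]
  rw [hd, pow_add, norm_mul]
  ring

theorem IsConvergentSeries.mul {n : ℕ} {f g : MvPowerSeries (Fin n) ℂ}
    (hf : IsConvergentSeries f) (hg : IsConvergentSeries g) : IsConvergentSeries (f * g) := by
  obtain ⟨r, hr, hf⟩ := hf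
  obtain ⟨s, hs, hg⟩ := hg
  have ht : 0 < min r s := lt_min hr hs
  have h := IsConvergentSeries.summable_antidiagonal
    (IsConvergentSeries.summable_of_le hf ht (min_le_left r s))
    (IsConvergentSeries.summable_of_le hg ht (min_le_right r s))
    (fun d => mul_nonneg (norm_nonneg _) (pow_nonneg ht.le _))
    (fun d => mul_nonneg (norm_nonneg _) (pow_nonneg ht.le _))
  exact ⟨min r s, ht, Summable.of_nonneg_of_le
    (fun d => mul_nonneg (norm_nonneg _) (pow_nonneg ht.le _))
    (fun d => IsConvergentSeries.norm_coeff_mul_le f g ht d) h⟩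

theorem IsConvergentSeries.monomial {n : ℕ} (e : Fin n →₀ ℕ) (a : ℂ) :
    IsConvergentSeries (MvPowerSeries.monomial e a) := by
  classical
  refine ⟨1, one_pos, summable_of_ne_finset_zero (s := {e}) fun d hd => ?_⟩
  rw [MvPowerSeries.coeff_monomial, if_neg (by simpa using hd)]
  simp

/-- The `ℂ`-algebra `ℂ{x_1, …, x_n}` of convergent power series. -/
noncomputable def ConvergentSeries (n : ℕ) : Subalgebra ℂ (MvPowerSeries (Fin n) ℂ) where
  carrier := {f | IsConvergentSeries f}
  mul_mem' := IsConvergentSeries.mul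
  add_mem' := IsConvergentSeries.add
  algebraMap_mem' a := IsConvergentSeries.monomial 0 a

/-- The coordinate `x_i` as an element of `ℂ{x_1, …, x_n}`. -/
noncomputable def ConvergentSeries.coord {n : ℕ} (i : Fin n) : ConvergentSeries n :=
  ⟨MvPowerSeries.X i, by
    change IsConvergentSeries (MvPowerSeries.X i)
    rw [MvPowerSeries.X_def]
    exact IsConvergentSeries.monomial (Finsupp.single i 1) 1⟩

/-- The non-zero quasihomogeneous part of least weight of `f ≠ 0` with respect to the weights
`w`: the sum of all terms of `f` whose weight is `wt f`. (For `f = 0` this is `0`.) -/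
noncomputable def leastWeightPart {n : ℕ} (w : Fin n → ℕ) (f : MvPowerSeries (Fin n) ℂ) :
    MvPowerSeries (Fin n) ℂ :=
  MvPowerSeries.weightedHomogeneousComponent w (f.weightedOrder w).toNat f

/-- An automorphism `Ψ` of the `ℂ`-algebra `ℂ{x_1, …, x_n}` is weight-respecting if
`wt Ψ(x_i) ≥ w_i` and `wt Ψ⁻¹(x_i) ≥ w_i` for all `i` (with `wt 0 = ∞`). -/
def IsWeightRespecting {n : ℕ} (w : Fin n → ℕ)
    (Ψ : ConvergentSeries n ≃ₐ[ℂ] ConvergentSeries n) : Prop :=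
  ∀ i : Fin n,
    (w i : ℕ∞) ≤ (Ψ (ConvergentSeries.coord i) : MvPowerSeries (Fin n) ℂ).weightedOrder w ∧
    (w i : ℕ∞) ≤ (Ψ.symm (ConvergentSeries.coord i) : MvPowerSeries (Fin n) ℂ).weightedOrder w

namespace ADENormalForm

/-- `x_{m+1}^2 + … + x_n^2` (the variable `x_{i+1}` has index `i : Fin n`). -/
noncomputable def squares (n m : ℕ) : MvPowerSeries (Fin n) ℂ :=
  ∑ i : Fin n with m ≤ i.val, MvPowerSeries.X i ^ 2

/-- `A_k`: `x_1^{k+1} + x_2^2 + … + x_n^2`. -/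
noncomputable def A (k : ℕ) {n : ℕ} (hn : 1 ≤ n) : MvPowerSeries (Fin n) ℂ :=
  MvPowerSeries.X ⟨0, hn⟩ ^ (k + 1) + squares n 1

/-- The variable `x_1`, for `n ≥ 2`. -/
noncomputable def x₁ {n : ℕ} (hn : 2 ≤ n) : MvPowerSeries (Fin n) ℂ :=
  MvPowerSeries.X ⟨0, Nat.lt_of_lt_of_le Nat.zero_lt_two hn⟩

/-- The variable `x_2`, for `n ≥ 2`. -/
noncomputable def x₂ {n : ℕ} (hn : 2 ≤ n) : MvPowerSeries (Fin n) ℂ :=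
  MvPowerSeries.X ⟨1, Nat.lt_of_lt_of_le Nat.one_lt_two hn⟩

/-- `D_k` (`k ≥ 4`): `x_1 (x_2^2 + x_1^{k-2}) + x_3^2 + … + x_n^2`. -/
noncomputable def D (k : ℕ) {n : ℕ} (hn : 2 ≤ n) : MvPowerSeries (Fin n) ℂ :=
  x₁ hn * (x₂ hn ^ 2 + x₁ hn ^ (k - 2)) + squares n 2

/-- `E_6`: `x_1^3 + x_2^4 + x_3^2 + … + x_n^2`. -/
noncomputable def E₆ {n : ℕ} (hn : 2 ≤ n) : MvPowerSeries (Fin n) ℂ :=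
  x₁ hn ^ 3 + x₂ hn ^ 4 + squares n 2

/-- `E_7`: `x_1 (x_1^2 + x_2^3) + x_3^2 + … + x_n^2`. -/
noncomputable def E₇ {n : ℕ} (hn : 2 ≤ n) : MvPowerSeries (Fin n) ℂ :=
  x₁ hn * (x₁ hn ^ 2 + x₂ hn ^ 3) + squares n 2

/-- `E_8`: `x_1^3 + x_2^5 + x_3^2 + … + x_n^2`. -/
noncomputable def E₈ {n : ℕ} (hn : 2 ≤ n) : MvPowerSeries (Fin n) ℂ :=
  x₁ hn ^ 3 + x₂ hn ^ 5 + squares n 2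

end ADENormalForm

/-- `g` is one of the normal forms `A_k` (`k ≥ 1`, `n ≥ 1`), `D_k` (`k ≥ 4`), `E_6`, `E_7`, `E_8`
(`n ≥ 2`) in the variables `x_1, …, x_n`. -/
def IsADENormalForm {n : ℕ} (g : MvPowerSeries (Fin n) ℂ) : Prop :=
  (∃ (hn : 1 ≤ n) (k : ℕ), 1 ≤ k ∧ g = ADENormalForm.A k hn) ∨
  ∃ hn : 2 ≤ n,
    (∃ k : ℕ, 4 ≤ k ∧ g = ADENormalForm.D k hn) ∨
    g = ADENormalForm.E₆ hn ∨ g = ADENormalForm.E₇ hn ∨ g = ADENormalForm.E₈ hn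

/-! Write `d = wt f`, `p = f_0` and `h = f - p`, so that `h` has only terms of weight above `d`. It
is enough to find a convergent `u`, with each `u_i` of order above `w_i`, such that `p(x + u) = p +
h`: the substitution `x + u` then takes `p` to `f`, and its inverse takes `f` to `p`.

By Taylor expansion the equation reads `∑ u_i ∂_i p = h - R(u)`, with `R` at least quadratic in `u`.
What distinguishes the types A, D, E is that every monomial of weight above `d` lies in the Jacobian
ideal of `p`. Finitely many such monomials divide all others, so series of order above `d` can be
divided by the `∂_i p` through linear operators `L_i` that shift weights by `w_i - d`
(`exists_jacobian_division`). It remains to solve `u = L(h - R(u))`.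

Because `R` is quadratic, the right-hand side raises the order of differences, so iteration from `0`
stabilises coefficientwise. Convergence comes from the norm `∑ |a_α| r^(wt α)`: `L_i` has norm at
most a constant times `r^(w_i - d)` without loss of radius, `h` is `O(r^(d+1))`, and `R(u)` is `O(ε²
r^d)` when `u_i` has norm at most `ε r^(w_i)`. For small `ε`, and then small `r`, the iteration
preserves this ball, and the bound passes to the formal limit (`exists_fixedPoint_of_contracting`,
`exists_aeval_shift_eq`). The same fixed point argument inverts `x + u` (`exists_inverse_shift`).
The Jacobian condition is checked by hand for each type. -/

open scoped ENNReal

/-! ### The filtration by weight -/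

/-- All coefficients of `f` of weight less than `m` vanish. -/
def VanishesBelow {n : ℕ} (w : Fin n → ℕ) (m : ℕ) (f : MvPowerSeries (Fin n) ℂ) : Prop :=
  ∀ α, Finsupp.weight w α < m → MvPowerSeries.coeff α f = 0

namespace VanishesBelow

variable {n : ℕ} {w : Fin n → ℕ} {a b : ℕ} {f g : MvPowerSeries (Fin n) ℂ}

theorem iff_le_weightedOrder : VanishesBelow w a f ↔ (a : ℕ∞) ≤ f.weightedOrder w :=
  ⟨fun h => MvPowerSeries.nat_le_weightedOrder w h, fun h _ hα =>
    MvPowerSeries.coeff_eq_zero_of_lt_weightedOrder w (lt_of_lt_of_le (by exact_mod_cast hα) h)⟩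

theorem mono (h : VanishesBelow w b f) (hab : a ≤ b) : VanishesBelow w a f :=
  fun α hα => h α (hα.trans_le hab)

theorem zero : VanishesBelow w a (0 : MvPowerSeries (Fin n) ℂ) := fun _ _ => map_zero _

theorem of_zero : VanishesBelow w 0 f := fun _ h => absurd h (Nat.not_lt_zero _)

theorem add (hf : VanishesBelow w a f) (hg : VanishesBelow w a g) :
    VanishesBelow w a (f + g) := fun α hα => by rw [map_add, hf α hα, hg α hα, add_zero]

theorem neg (hf : VanishesBelow w a f) : VanishesBelow w a (-f) :=
  fun α hα => by rw [map_neg, hf α hα, neg_zero]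

theorem sub (hf : VanishesBelow w a f) (hg : VanishesBelow w a g) :
    VanishesBelow w a (f - g) := fun α hα => by rw [map_sub, hf α hα, hg α hα, sub_zero]

theorem sum {ι : Type*} {s : Finset ι} {F : ι → MvPowerSeries (Fin n) ℂ}
    (h : ∀ i ∈ s, VanishesBelow w a (F i)) : VanishesBelow w a (∑ i ∈ s, F i) :=
  fun α hα => by
    rw [map_sum]
    exact Finset.sum_eq_zero fun i hi => h i hi α hα

theorem mul (hf : VanishesBelow w a f) (hg : VanishesBelow w b g) :
    VanishesBelow w (a + b) (f * g) := fun α hα => by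
  classical
  rw [MvPowerSeries.coeff_mul]
  refine Finset.sum_eq_zero fun p hp => ?_
  rw [← Finset.HasAntidiagonal.mem_antidiagonal.mp hp, map_add] at hα
  by_cases h : Finsupp.weight w p.1 < a
  · rw [hf _ h, zero_mul]
  · rw [hg _ (by omega), mul_zero]

theorem X (i : Fin n) : VanishesBelow w (w i) (MvPowerSeries.X i : MvPowerSeries (Fin n) ℂ) :=
  fun α hα => by
    classical
    rw [MvPowerSeries.coeff_X, if_neg]
    rintro rfl
    simp [Finsupp.weight_single] at hα

/-- The filtration is separated, because every exponent has finite weight. -/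
theorem eq_of_forall (h : ∀ m, VanishesBelow w m (f - g)) : f = g := by
  ext α
  simpa [sub_eq_zero] using h (Finsupp.weight w α + 1) α (Nat.lt_succ_self _)

theorem constantCoeff_eq_zero (hf : VanishesBelow w (a + 1) f) :
    MvPowerSeries.constantCoeff f = 0 := by
  rw [← MvPowerSeries.coeff_zero_eq_constantCoeff_apply]
  exact hf 0 (by simp)

end VanishesBelow

/-! ### Weighted norms of power series -/

/-- The weighted norm `∑ |a_α| r^{wt α}` of `f = ∑ a_α x^α`. -/
noncomputable def weightedNorm {n : ℕ} (w : Fin n → ℕ) (r : ℝ≥0∞)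
    (f : MvPowerSeries (Fin n) ℂ) : ℝ≥0∞ :=
  ∑' α, ‖MvPowerSeries.coeff α f‖ₑ * r ^ Finsupp.weight w α

namespace weightedNorm

variable {n : ℕ} {w : Fin n → ℕ} {r s : ℝ≥0∞} {f g : MvPowerSeries (Fin n) ℂ}

theorem zero : weightedNorm w r (0 : MvPowerSeries (Fin n) ℂ) = 0 := by
  simp [weightedNorm]

theorem neg : weightedNorm w r (-f) = weightedNorm w r f := by
  simp [weightedNorm]

theorem add_le : weightedNorm w r (f + g) ≤ weightedNorm w r f + weightedNorm w r g := by
  rw [weightedNorm, weightedNorm, weightedNorm, ← ENNReal.tsum_add]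
  refine ENNReal.tsum_le_tsum fun α => ?_
  rw [← add_mul, map_add]
  gcongr
  exact enorm_add_le _ _

theorem sub_le : weightedNorm w r (f - g) ≤ weightedNorm w r f + weightedNorm w r g := by
  rw [sub_eq_add_neg, ← neg (f := g)]
  exact add_le

theorem sum_le {ι : Type*} (s : Finset ι) (F : ι → MvPowerSeries (Fin n) ℂ) :
    weightedNorm w r (∑ i ∈ s, F i) ≤ ∑ i ∈ s, weightedNorm w r (F i) := by
  classical
  induction s using Finset.induction_on with
  | empty => simp [zero]
  | insert i s hi ih =>
    rw [Finset.sum_insert hi, Finset.sum_insert hi]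
    exact add_le.trans (by gcongr)

theorem monomial (α : Fin n →₀ ℕ) (c : ℂ) :
    weightedNorm w r (MvPowerSeries.monomial α c) = ‖c‖ₑ * r ^ Finsupp.weight w α := by
  classical
  rw [weightedNorm, tsum_eq_single α]
  · rw [MvPowerSeries.coeff_monomial_same]
  · intro β hβ
    rw [MvPowerSeries.coeff_monomial_ne hβ, enorm_zero, zero_mul]

theorem X (i : Fin n) :
    weightedNorm w r (MvPowerSeries.X i : MvPowerSeries (Fin n) ℂ) = r ^ w i := by
  rw [MvPowerSeries.X_def, monomial]
  simp [Finsupp.weight_single]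

theorem one : weightedNorm w r (1 : MvPowerSeries (Fin n) ℂ) = 1 := by
  rw [← MvPowerSeries.monomial_zero_one, monomial]
  simp

/-- The Cauchy product bound. With values in `ℝ≥0∞` the double sum may be rearranged without any
convergence hypothesis. -/
theorem mul_le : weightedNorm w r (f * g) ≤ weightedNorm w r f * weightedNorm w r g := by
  classical
  set F : (Fin n →₀ ℕ) → ℝ≥0∞ := fun α => ‖MvPowerSeries.coeff α f‖ₑ * r ^ Finsupp.weight w α
  set G : (Fin n →₀ ℕ) → ℝ≥0∞ := fun α => ‖MvPowerSeries.coeff α g‖ₑ * r ^ Finsupp.weight w α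
  calc weightedNorm w r (f * g)
      ≤ ∑' α, ∑ p ∈ Finset.HasAntidiagonal.antidiagonal α, F p.1 * G p.2 := by
        refine ENNReal.tsum_le_tsum fun α => ?_
        rw [MvPowerSeries.coeff_mul]
        calc _ ≤ (∑ p ∈ Finset.HasAntidiagonal.antidiagonal α, ‖MvPowerSeries.coeff p.1 f *
              MvPowerSeries.coeff p.2 g‖ₑ) * r ^ Finsupp.weight w α := by
              gcongr
              exact enorm_sum_le _ _
          _ = _ := by
              rw [Finset.sum_mul]
              refine Finset.sum_congr rfl fun p hp => ?_
              rw [← Finset.HasAntidiagonal.mem_antidiagonal.mp hp, map_add, pow_add, enorm_mul]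
              ring
    _ = ∑' α, ∑' p : Finset.HasAntidiagonal.antidiagonal α, F p.1.1 * G p.1.2 := by
        refine tsum_congr fun α => ?_
        rw [tsum_fintype, ← Finset.sum_coe_sort]
    _ = ∑' q : (Σ α : Fin n →₀ ℕ, Finset.HasAntidiagonal.antidiagonal α), F q.2.1.1 * G q.2.1.2 :=
        (ENNReal.tsum_sigma' (fun q : (Σ α : Fin n →₀ ℕ, Finset.HasAntidiagonal.antidiagonal α) =>
          F q.2.1.1 * G q.2.1.2)).symm
    _ = ∑' p : (Fin n →₀ ℕ) × (Fin n →₀ ℕ), F p.1 * G p.2 :=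
        Finset.HasAntidiagonal.sigmaAntidiagonalEquivProd.tsum_eq
          (fun p : (Fin n →₀ ℕ) × (Fin n →₀ ℕ) => F p.1 * G p.2)
    _ = ∑' α, ∑' β, F α * G β := ENNReal.tsum_prod'
    _ = weightedNorm w r f * weightedNorm w r g := by
        simp_rw [ENNReal.tsum_mul_left, ENNReal.tsum_mul_right]
        rfl

theorem pow_le (k : ℕ) : weightedNorm w r (f ^ k) ≤ weightedNorm w r f ^ k := by
  induction k with
  | zero => rw [pow_zero, pow_zero, one]
  | succ k ih =>
    rw [pow_succ, pow_succ]
    exact mul_le.trans (by gcongr)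

theorem prod_le {ι : Type*} (s : Finset ι) (F : ι → MvPowerSeries (Fin n) ℂ) :
    weightedNorm w r (∏ i ∈ s, F i) ≤ ∏ i ∈ s, weightedNorm w r (F i) := by
  classical
  induction s using Finset.induction_on with
  | empty => simp [one]
  | insert i s hi ih =>
    rw [Finset.prod_insert hi, Finset.prod_insert hi]
    exact mul_le.trans (by gcongr)

theorem mono (hrs : r ≤ s) : weightedNorm w r f ≤ weightedNorm w s f :=
  ENNReal.tsum_le_tsum fun α => by gcongr

/-- A Schwarz lemma: every exponent that occurs has weight `m + k`, and of the factor `r ^ (m + k)`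
only `r ^ k` is enlarged to `s ^ k`. The form without division needs no condition on `s` being
non-zero or finite. -/
theorem mul_pow_le_of_vanishesBelow {m : ℕ} (hf : VanishesBelow w m f) (hrs : r ≤ s) :
    weightedNorm w r f * s ^ m ≤ r ^ m * weightedNorm w s f := by
  rw [weightedNorm, weightedNorm, ← ENNReal.tsum_mul_left, ← ENNReal.tsum_mul_right]
  refine ENNReal.tsum_le_tsum fun α => ?_
  rcases lt_or_ge (Finsupp.weight w α) m with h | h
  · simp [hf α h]
  · obtain ⟨k, hk⟩ := Nat.exists_eq_add_of_le h
    rw [hk, pow_add, pow_add]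
    calc _ = ‖MvPowerSeries.coeff α f‖ₑ * (r ^ m * r ^ k) * s ^ m := rfl
      _ ≤ ‖MvPowerSeries.coeff α f‖ₑ * (r ^ m * s ^ k) * s ^ m := by gcongr
      _ = _ := by ring

/-- A series of order at least `m` has norm `O(r^m)`. -/
theorem exists_le_mul_pow {m : ℕ} (hf : VanishesBelow w m f) (hs₀ : s ≠ 0) (hs : s ≠ ∞)
    (hN : weightedNorm w s f ≠ ∞) :
    ∃ K ≠ ∞, ∀ r ≤ s, weightedNorm w r f ≤ K * r ^ m := by
  refine ⟨weightedNorm w s f / s ^ m, ENNReal.div_ne_top hN (pow_ne_zero _ hs₀), fun r hr => ?_⟩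
  have := mul_pow_le_of_vanishesBelow hf hr
  rw [← ENNReal.mul_div_right_comm, ENNReal.le_div_iff_mul_le (Or.inl (pow_ne_zero _ hs₀))
    (Or.inl (ENNReal.pow_ne_top hs))]
  rwa [mul_comm (weightedNorm w s f)]

theorem coe_ne_top (p : MvPolynomial (Fin n) ℂ) (hr : r ≠ ∞) :
    weightedNorm w r (p : MvPowerSeries (Fin n) ℂ) ≠ ∞ := by
  classical
  rw [weightedNorm, tsum_eq_sum (s := p.support)]
  · exact ENNReal.sum_ne_top.mpr fun α _ =>
      ENNReal.mul_ne_top enorm_ne_top (ENNReal.pow_ne_top hr)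
  · intro α hα
    rw [MvPolynomial.coeff_coe, MvPolynomial.notMem_support_iff.mp hα, enorm_zero, zero_mul]

/-- Substitution is controlled by the norms of the substituted series. -/
theorem subst_le {a : Fin n → MvPowerSeries (Fin n) ℂ} (ha : MvPowerSeries.HasSubst a)
    (h : ∀ i, weightedNorm w r (a i) ≤ s ^ w i) :
    weightedNorm w r (g.subst a) ≤ weightedNorm w s g := by
  classical
  have hprod (α : Fin n →₀ ℕ) :
      weightedNorm w r (α.prod fun i e => a i ^ e) ≤ s ^ Finsupp.weight w α := by
    rw [Finsupp.prod, Finsupp.weight_apply, Finsupp.sum, ← Finset.prod_pow_eq_pow_sum]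
    refine (prod_le _ _).trans (Finset.prod_le_prod' fun i _ => (pow_le _).trans ?_)
    rw [smul_eq_mul, mul_comm, pow_mul]
    gcongr
    exact h i
  calc weightedNorm w r (g.subst a)
      ≤ ∑' β, ∑' α, ‖MvPowerSeries.coeff α g‖ₑ *
          (‖MvPowerSeries.coeff β (α.prod fun i e => a i ^ e)‖ₑ * r ^ Finsupp.weight w β) := by
        refine ENNReal.tsum_le_tsum fun β => ?_
        rw [MvPowerSeries.coeff_subst ha, finsum_eq_sum _ (MvPowerSeries.coeff_subst_finite ha g β)]
        refine le_trans ?_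
          (ENNReal.sum_le_tsum (MvPowerSeries.coeff_subst_finite ha g β).toFinset)
        refine (mul_le_mul_left (enorm_sum_le _ _) _).trans (le_of_eq ?_)
        rw [Finset.sum_mul]
        refine Finset.sum_congr rfl fun α _ => ?_
        rw [smul_eq_mul, enorm_mul, mul_assoc]
    _ = ∑' α, ‖MvPowerSeries.coeff α g‖ₑ * weightedNorm w r (α.prod fun i e => a i ^ e) := by
        rw [ENNReal.tsum_comm]
        simp_rw [ENNReal.tsum_mul_left]
        rfl
    _ ≤ weightedNorm w s g := ENNReal.tsum_le_tsum fun α => by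
        gcongr
        exact hprod α

end weightedNorm

/-! ### Fixed points in the weight filtration -/

/-- A system of equations `u = T u` in power series has a solution if `T` raises the order of
differences; a bound on the weighted norm preserved by `T` is inherited by the solution. -/
theorem exists_fixedPoint_of_contracting {n : ℕ} {w : Fin n → ℕ} {r : ℝ≥0∞} {B : Fin n → ℝ≥0∞}
    (T : (Fin n → MvPowerSeries (Fin n) ℂ) → Fin n → MvPowerSeries (Fin n) ℂ)
    (hdom : ∀ u, (∀ i, VanishesBelow w (w i + 1) (u i)) → ∀ i, VanishesBelow w (w i + 1) (T u i))
    (hlip : ∀ u v m, (∀ i, VanishesBelow w (w i + 1) (u i)) →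
      (∀ i, VanishesBelow w (w i + 1) (v i)) → (∀ i, VanishesBelow w (w i + m) (u i - v i)) →
      ∀ i, VanishesBelow w (w i + m + 1) (T u i - T v i))
    (hbound : ∀ u, (∀ i, VanishesBelow w (w i + 1) (u i)) →
      (∀ i, weightedNorm w r (u i) ≤ B i) → ∀ i, weightedNorm w r (T u i) ≤ B i) :
    ∃ u, (∀ i, VanishesBelow w (w i + 1) (u i)) ∧ T u = u ∧
      ∀ i, weightedNorm w r (u i) ≤ B i := by
  set U : ℕ → Fin n → MvPowerSeries (Fin n) ℂ := fun k => T^[k] 0 with hU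
  have hsucc (k : ℕ) : U (k + 1) = T (U k) := Function.iterate_succ_apply' _ _ _
  have hUdom (k : ℕ) : ∀ i, VanishesBelow w (w i + 1) (U k i) := by
    induction k with
    | zero => exact fun i => VanishesBelow.zero
    | succ k ih => rw [hsucc]; exact hdom _ ih
  have hUbound (k : ℕ) : ∀ i, weightedNorm w r (U k i) ≤ B i := by
    induction k with
    | zero => exact fun i => weightedNorm.zero.le.trans zero_le
    | succ k ih => rw [hsucc]; exact hbound _ (hUdom k) ih
  have hstep (k : ℕ) : ∀ i, VanishesBelow w (w i + k) (U (k + 1) i - U k i) := by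
    induction k with
    | zero => exact fun i => ((hUdom 1 i).sub (hUdom 0 i)).mono (by omega)
    | succ k ih =>
      intro i
      have := hlip _ _ _ (hUdom _) (hUdom _) ih i
      rwa [← hsucc, ← hsucc] at this
  have hle (k l : ℕ) (hkl : k ≤ l) : ∀ i, VanishesBelow w (w i + k) (U l i - U k i) := by
    induction l, hkl using Nat.le_induction with
    | base => intro i; rw [sub_self]; exact VanishesBelow.zero
    | succ l hl ih =>
      intro i
      rw [← sub_add_sub_cancel (U (l + 1) i) (U l i)]
      exact ((hstep l i).mono (by omega)).add (ih i)
  -- The limit is read off diagonally: the coefficient at `α` no longer changes from the iterate of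
  -- index `weight α + 1` on.
  set u : Fin n → MvPowerSeries (Fin n) ℂ :=
    fun i α => MvPowerSeries.coeff α (U (Finsupp.weight w α + 1) i) with hu
  have hcoeff (i : Fin n) (α) :
      MvPowerSeries.coeff α (u i) = MvPowerSeries.coeff α (U (Finsupp.weight w α + 1) i) := rfl
  have hcoeff' (i : Fin n) (α) (k : ℕ) (hk : Finsupp.weight w α < w i + k) :
      MvPowerSeries.coeff α (u i) = MvPowerSeries.coeff α (U k i) := by
    rw [hcoeff]
    rcases le_total k (Finsupp.weight w α + 1) with h | h
    · have := hle _ _ h i α hk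
      rwa [map_sub, sub_eq_zero] at this
    · have := hle _ _ h i α (by omega)
      rw [map_sub, sub_eq_zero] at this
      exact this.symm
  have hudom : ∀ i, VanishesBelow w (w i + 1) (u i) :=
    fun i α hα => (hcoeff i α).trans (hUdom _ i α hα)
  have hclose (k : ℕ) (i : Fin n) : VanishesBelow w (w i + k) (u i - U k i) :=
    fun α hα => by rw [map_sub, hcoeff' i α k hα, sub_self]
  refine ⟨u, hudom, ?_, fun i => ?_⟩
  · ext1 i
    refine VanishesBelow.eq_of_forall (w := w) fun m => ?_
    rw [← sub_sub_sub_cancel_right _ _ (U (m + 1) i)]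
    refine VanishesBelow.sub ?_ ((hclose (m + 1) i).mono (by omega))
    rw [hsucc]
    exact (hlip _ _ _ hudom (hUdom m) (hclose m) i).mono (by omega)
  -- A finite partial sum of the norm of `u i` is also one of a single late iterate, so the bound
  -- passes to the limit without convergence in norm.
  · refine ENNReal.summable.tsum_le_of_sum_le fun s => ?_
    refine le_trans (le_of_eq ?_) ((ENNReal.sum_le_tsum s).trans
      (hUbound (s.sup (Finsupp.weight w) + 1) i))
    refine Finset.sum_congr rfl fun α hα => ?_
    have := Finset.le_sup (f := Finsupp.weight w) hα
    rw [hcoeff' i α (s.sup (Finsupp.weight w) + 1) (by omega)]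

/-! ### Shifts and Taylor remainders of weighted homogeneous polynomials -/

/-- Induction on weighted homogeneous polynomials through products and sums. -/
theorem MvPolynomial.IsWeightedHomogeneous.induction_mul_add {n : ℕ} {w : Fin n → ℕ}
    {P : ℕ → MvPolynomial (Fin n) ℂ → Prop}
    (hC : ∀ c, P 0 (MvPolynomial.C c)) (hX : ∀ i, P (w i) (MvPolynomial.X i))
    (hmul : ∀ d e p q, P d p → P e q → P (d + e) (p * q)) (hzero : ∀ d, P d 0)
    (hadd : ∀ d p q, P d p → P d q → P d (p + q)) {d : ℕ} {p : MvPolynomial (Fin n) ℂ}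
    (hp : p.IsWeightedHomogeneous w d) : P d p := by
  have hmon (α : Fin n →₀ ℕ) :
      P (Finsupp.weight w α) (MvPolynomial.monomial α 1) := by
    induction α using Finsupp.induction_linear with
    | zero => simpa using hC 1
    | add α β hα hβ =>
      simpa [MvPolynomial.monomial_mul] using hmul _ _ _ _ hα hβ
    | single i k =>
      rw [Finsupp.weight_single, smul_eq_mul]
      induction k with
      | zero => simpa using hC 1
      | succ k ih =>
        rw [← MvPolynomial.X_pow_eq_monomial] at ih ⊢
        rw [pow_succ, Nat.succ_mul]
        exact hmul _ _ _ _ ih (hX i)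
  rw [p.as_sum]
  refine Finset.sum_induction _ (P d) (hadd d) (hzero d) fun α hα => ?_
  rw [← hp (MvPolynomial.mem_support_iff.mp hα), ← mul_one (MvPolynomial.coeff α p),
    ← MvPolynomial.C_mul_monomial, ← Nat.zero_add (Finsupp.weight w α)]
  exact hmul _ _ _ _ (hC _) (hmon α)

namespace MvPolynomial.IsWeightedHomogeneous

variable {n : ℕ} {w : Fin n → ℕ} {d : ℕ} {p : MvPolynomial (Fin n) ℂ}

theorem vanishesBelow_coe (hp : p.IsWeightedHomogeneous w d) :
    VanishesBelow w d (p : MvPowerSeries (Fin n) ℂ) := fun α hα => by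
  rw [MvPolynomial.coeff_coe]
  exact hp.coeff_eq_zero α hα.ne

theorem vanishesBelow_aeval (hp : p.IsWeightedHomogeneous w d)
    {a : Fin n → MvPowerSeries (Fin n) ℂ} (ha : ∀ i, VanishesBelow w (w i) (a i)) :
    VanishesBelow w d (MvPolynomial.aeval a p) := by
  refine hp.induction_mul_add (P := fun d p => VanishesBelow w d (MvPolynomial.aeval a p))
    (fun c => VanishesBelow.of_zero) (fun i => ?_) (fun d e p q h₁ h₂ => ?_) (fun d => ?_)
    (fun d p q h₁ h₂ => ?_)
  · rw [MvPolynomial.aeval_X]; exact ha i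
  · rw [map_mul]; exact h₁.mul h₂
  · rw [map_zero]; exact VanishesBelow.zero
  · rw [map_add]; exact h₁.add h₂

theorem vanishesBelow_aeval_sub_aeval (hp : p.IsWeightedHomogeneous w d) {m : ℕ}
    {a b : Fin n → MvPowerSeries (Fin n) ℂ} (ha : ∀ i, VanishesBelow w (w i) (a i))
    (hb : ∀ i, VanishesBelow w (w i) (b i)) (hab : ∀ i, VanishesBelow w (w i + m) (a i - b i)) :
    VanishesBelow w (d + m) (MvPolynomial.aeval a p - MvPolynomial.aeval b p) := by
  refine (hp.induction_mul_add (P := fun d p => VanishesBelow w d (MvPolynomial.aeval a p) ∧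
    VanishesBelow w d (MvPolynomial.aeval b p) ∧
    VanishesBelow w (d + m) (MvPolynomial.aeval a p - MvPolynomial.aeval b p))
    (fun c => ?_) (fun i => ?_) ?_ (fun d => ?_) ?_).2.2
  · rw [MvPolynomial.aeval_C, MvPolynomial.aeval_C, sub_self]
    exact ⟨VanishesBelow.of_zero, VanishesBelow.of_zero, VanishesBelow.zero⟩
  · rw [MvPolynomial.aeval_X, MvPolynomial.aeval_X]
    exact ⟨ha i, hb i, hab i⟩
  · rintro d e p q ⟨h₁, h₂, h₃⟩ ⟨k₁, k₂, k₃⟩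
    rw [map_mul, map_mul]
    refine ⟨h₁.mul k₁, h₂.mul k₂, ?_⟩
    rw [show ∀ x y z t : MvPowerSeries (Fin n) ℂ, x * y - z * t = (x - z) * y + z * (y - t) by
      intros; ring]
    exact ((h₃.mul k₁).mono (by omega)).add ((h₂.mul k₃).mono (by omega))
  · rw [map_zero, map_zero, sub_zero]
    exact ⟨VanishesBelow.zero, VanishesBelow.zero, VanishesBelow.zero⟩
  · rintro d p q ⟨h₁, h₂, h₃⟩ ⟨k₁, k₂, k₃⟩
    rw [map_add, map_add, add_sub_add_comm]
    exact ⟨h₁.add k₁, h₂.add k₂, h₃.add k₃⟩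

end MvPolynomial.IsWeightedHomogeneous

/-- The substitution `x + u` for a family `u` of power series. -/
noncomputable def shift {n : ℕ} (u : Fin n → MvPowerSeries (Fin n) ℂ) :
    Fin n → MvPowerSeries (Fin n) ℂ := fun i => MvPowerSeries.X i + u i

/-- The remainder `p(x + u) - p(x) - ∑ u_i ∂_i p(x)` of the first order Taylor expansion. -/
noncomputable def taylorRemainder {n : ℕ} (u : Fin n → MvPowerSeries (Fin n) ℂ)
    (p : MvPolynomial (Fin n) ℂ) : MvPowerSeries (Fin n) ℂ :=
  MvPolynomial.aeval (shift u) p - p - ∑ i, u i * (MvPolynomial.pderiv i p : MvPolynomial _ ℂ)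

theorem MvPolynomial.aeval_X_eq_coe {n : ℕ} (p : MvPolynomial (Fin n) ℂ) :
    MvPolynomial.aeval (MvPowerSeries.X : Fin n → MvPowerSeries (Fin n) ℂ) p = p := by
  rw [← MvPowerSeries.subst_coe, MvPowerSeries.subst_self, id]

namespace taylorRemainder

variable {n : ℕ} {w : Fin n → ℕ} {u v : Fin n → MvPowerSeries (Fin n) ℂ}

theorem C (c : ℂ) : taylorRemainder u (MvPolynomial.C c) = 0 := by
  simp [taylorRemainder, MvPowerSeries.algebraMap_apply]

theorem X (i : Fin n) : taylorRemainder u (MvPolynomial.X i) = 0 := by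
  classical
  simp only [taylorRemainder, shift, MvPolynomial.aeval_X, MvPolynomial.coe_X,
    MvPolynomial.pderiv_X]
  rw [Finset.sum_eq_single i]
  · simp
  · intro j _ hj
    simp [Pi.single_eq_of_ne hj.symm]
  · simp

theorem add (p q : MvPolynomial (Fin n) ℂ) :
    taylorRemainder u (p + q) = taylorRemainder u p + taylorRemainder u q := by
  simp only [taylorRemainder, map_add, MvPolynomial.coe_add, mul_add, Finset.sum_add_distrib]
  ring

theorem zero : taylorRemainder u 0 = 0 := by
  simp [taylorRemainder]

/-- The product of the two first differences is the only new term. As the remainder vanishes on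
constants and coordinates, this term is the source of all quadratic behaviour in `u`, and estimates
follow by induction from linear ones for the first differences. -/
theorem mul (p q : MvPolynomial (Fin n) ℂ) :
    taylorRemainder u (p * q) =
      (MvPolynomial.aeval (shift u) p - p) * (MvPolynomial.aeval (shift u) q - q) +
        taylorRemainder u p * q + p * taylorRemainder u q := by
  have : ∑ i, u i * (MvPolynomial.pderiv i (p * q) : MvPolynomial _ ℂ) =
      (∑ i, u i * (MvPolynomial.pderiv i p : MvPolynomial _ ℂ)) * q +
        p * ∑ i, u i * ((MvPolynomial.pderiv i q : MvPolynomial _ ℂ) :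
          MvPowerSeries (Fin n) ℂ) := by
    rw [Finset.sum_mul, Finset.mul_sum, ← Finset.sum_add_distrib]
    refine Finset.sum_congr rfl fun i _ => ?_
    rw [MvPolynomial.pderiv_mul, MvPolynomial.coe_add, MvPolynomial.coe_mul, MvPolynomial.coe_mul]
    ring
  rw [taylorRemainder, this, taylorRemainder, taylorRemainder, map_mul, MvPolynomial.coe_mul]
  ring

/-- The extra order is what makes the iteration contract. When the products of first differences for
`u` and `v` are compared, one factor is a difference of the two shifts and gains `m`, while the
other is a first difference and gains `1`. -/
theorem vanishesBelow_sub {d m : ℕ} {p : MvPolynomial (Fin n) ℂ}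
    (hp : p.IsWeightedHomogeneous w d) (hu : ∀ i, VanishesBelow w (w i + 1) (u i))
    (hv : ∀ i, VanishesBelow w (w i + 1) (v i)) (huv : ∀ i, VanishesBelow w (w i + m) (u i - v i)) :
    VanishesBelow w (d + m + 1) (taylorRemainder u p - taylorRemainder v p) := by
  have hs {u : Fin n → MvPowerSeries (Fin n) ℂ} (hu : ∀ i, VanishesBelow w (w i + 1) (u i))
      (i) : VanishesBelow w (w i) (shift u i) :=
    (VanishesBelow.X i).add ((hu i).mono (by omega))
  have h₁ {u : Fin n → MvPowerSeries (Fin n) ℂ} (hu : ∀ i, VanishesBelow w (w i + 1) (u i))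
      {d : ℕ} {p : MvPolynomial (Fin n) ℂ} (hp : p.IsWeightedHomogeneous w d) :
      VanishesBelow w (d + 1) (MvPolynomial.aeval (shift u) p - p) := by
    rw [← MvPolynomial.aeval_X_eq_coe p]
    refine hp.vanishesBelow_aeval_sub_aeval (hs hu) VanishesBelow.X fun i => ?_
    rw [shift, add_sub_cancel_left]
    exact hu i
  have h₂ {d : ℕ} {p : MvPolynomial (Fin n) ℂ} (hp : p.IsWeightedHomogeneous w d) :
      VanishesBelow w (d + m) (MvPolynomial.aeval (shift u) p - MvPolynomial.aeval (shift v) p) :=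
    hp.vanishesBelow_aeval_sub_aeval (hs hu) (hs hv) fun i => by
      rw [shift, shift, add_sub_add_left_eq_sub]
      exact huv i
  refine (hp.induction_mul_add (P := fun d p => p.IsWeightedHomogeneous w d ∧
    VanishesBelow w (d + m + 1) (taylorRemainder u p - taylorRemainder v p))
    (fun c => ?_) (fun i => ?_) ?_ (fun d => ?_) ?_).2
  · rw [C, C, sub_zero]
    exact ⟨MvPolynomial.isWeightedHomogeneous_C _ _, VanishesBelow.zero⟩
  · rw [X, X, sub_zero]
    exact ⟨MvPolynomial.isWeightedHomogeneous_X _ _ _, VanishesBelow.zero⟩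
  · rintro d e p q ⟨hp, hp'⟩ ⟨hq, hq'⟩
    refine ⟨hp.mul hq, ?_⟩
    rw [mul, mul]
    set a := MvPolynomial.aeval (shift u) p
    set b := MvPolynomial.aeval (shift u) q
    set a' := MvPolynomial.aeval (shift v) p
    set b' := MvPolynomial.aeval (shift v) q
    rw [show (a - p) * (b - q) + taylorRemainder u p * q + p * taylorRemainder u q -
      ((a' - p) * (b' - q) + taylorRemainder v p * q + p * taylorRemainder v q) =
      (a - a') * (b - q) + (a' - p) * (b - b') + (taylorRemainder u p - taylorRemainder v p) * q +
      p * (taylorRemainder u q - taylorRemainder v q) by ring]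
    exact (((((h₂ hp).mul (h₁ hu hq)).mono (by omega)).add
      (((h₁ hv hp).mul (h₂ hq)).mono (by omega))).add
      ((hp'.mul hq.vanishesBelow_coe).mono (by omega))).add
      ((hp.vanishesBelow_coe.mul hq').mono (by omega))
  · rw [zero, zero, sub_zero]
    exact ⟨MvPolynomial.isWeightedHomogeneous_zero _ _ _, VanishesBelow.zero⟩
  · rintro d p q ⟨hp, hp'⟩ ⟨hq, hq'⟩
    rw [add, add, add_sub_add_comm]
    exact ⟨hp.add hq, hp'.add hq'⟩

theorem vanishesBelow {d : ℕ} {p : MvPolynomial (Fin n) ℂ}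
    (hp : p.IsWeightedHomogeneous w d) (hu : ∀ i, VanishesBelow w (w i + 1) (u i)) :
    VanishesBelow w (d + 1) (taylorRemainder u p) := by
  -- Comparison with the zero shift, whose remainder is zero; this gives order `d + 2`, of which `d
  -- + 1` is kept.
  have h := vanishesBelow_sub (v := 0) (m := 1) hp hu (fun i => VanishesBelow.zero)
    (fun i => by simpa using hu i)
  have h0 : taylorRemainder 0 p = 0 := by
    have : shift (0 : Fin n → MvPowerSeries (Fin n) ℂ) = MvPowerSeries.X := by
      ext1 i
      simp [shift]
    rw [taylorRemainder, this, MvPolynomial.aeval_X_eq_coe]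
    simp
  rw [h0, sub_zero] at h
  exact h.mono (by omega)

/-- Relative size `ε` of the shift gives relative size `ε ^ 2` of the remainder. The constant
depends on `p` alone, which leaves `ε` and `r` free to be chosen afterwards. -/
theorem exists_weightedNorm_le {d : ℕ} {p : MvPolynomial (Fin n) ℂ}
    (hp : p.IsWeightedHomogeneous w d) :
    ∃ K ≠ ∞, ∀ (r ε : ℝ≥0∞) (u : Fin n → MvPowerSeries (Fin n) ℂ), ε ≤ 1 →
      (∀ i, weightedNorm w r (u i) ≤ ε * r ^ w i) →
      weightedNorm w r (taylorRemainder u p) ≤ K * ε ^ 2 * r ^ d := by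
  -- The product formula for the remainder involves `p` itself and its first difference, so the
  -- induction carries bounds for all three.
  suffices ∃ K ≠ ∞, ∀ (r ε : ℝ≥0∞) (u : Fin n → MvPowerSeries (Fin n) ℂ), ε ≤ 1 →
      (∀ i, weightedNorm w r (u i) ≤ ε * r ^ w i) →
      weightedNorm w r (p : MvPowerSeries (Fin n) ℂ) ≤ K * r ^ d ∧
      weightedNorm w r (MvPolynomial.aeval (shift u) p - p) ≤ K * ε * r ^ d ∧
      weightedNorm w r (taylorRemainder u p) ≤ K * ε ^ 2 * r ^ d by
    obtain ⟨K, hK, h⟩ := this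
    exact ⟨K, hK, fun r ε u hε hu => (h r ε u hε hu).2.2⟩
  refine hp.induction_mul_add (P := fun d p => ∃ K ≠ ∞, ∀ (r ε : ℝ≥0∞)
      (u : Fin n → MvPowerSeries (Fin n) ℂ), ε ≤ 1 →
      (∀ i, weightedNorm w r (u i) ≤ ε * r ^ w i) →
      weightedNorm w r (p : MvPowerSeries (Fin n) ℂ) ≤ K * r ^ d ∧
      weightedNorm w r (MvPolynomial.aeval (shift u) p - p) ≤ K * ε * r ^ d ∧
      weightedNorm w r (taylorRemainder u p) ≤ K * ε ^ 2 * r ^ d)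
    (fun c => ?_) (fun i => ?_) ?_ (fun d => ?_) ?_
  · refine ⟨‖c‖ₑ, enorm_ne_top, fun r ε u hε hu => ⟨?_, ?_, ?_⟩⟩
    · rw [MvPolynomial.coe_C, ← MvPowerSeries.monomial_zero_eq_C_apply, weightedNorm.monomial]
      simp
    · simp [MvPowerSeries.algebraMap_apply, weightedNorm.zero]
    · rw [C, weightedNorm.zero]
      exact zero_le
  · refine ⟨1, ENNReal.one_ne_top, fun r ε u hε hu => ⟨?_, ?_, ?_⟩⟩
    · rw [MvPolynomial.coe_X, weightedNorm.X, one_mul]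
    · rw [MvPolynomial.coe_X, MvPolynomial.aeval_X, shift, add_sub_cancel_left, one_mul]
      exact hu i
    · rw [X, weightedNorm.zero]
      exact zero_le
  · rintro d e p q ⟨K, hK, h⟩ ⟨M, hM, k⟩
    -- The first difference and the remainder of a product each have three terms; `ε ≤ 1` absorbs
    -- the surplus `ε` in the product of first differences.
    refine ⟨3 * (K * M), ENNReal.mul_ne_top (by simp) (ENNReal.mul_ne_top hK hM),
      fun r ε u hε hu => ?_⟩
    obtain ⟨h₁, h₂, h₃⟩ := h r ε u hε hu
    obtain ⟨k₁, k₂, k₃⟩ := k r ε u hε hu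
    refine ⟨?_, ?_, ?_⟩
    · rw [MvPolynomial.coe_mul]
      calc _ ≤ (K * r ^ d) * (M * r ^ e) := weightedNorm.mul_le.trans (by gcongr)
        _ = 1 * (K * M) * r ^ (d + e) := by ring
        _ ≤ _ := by gcongr; norm_num
    · rw [map_mul, MvPolynomial.coe_mul]
      set a := MvPolynomial.aeval (shift u) p
      set b := MvPolynomial.aeval (shift u) q
      rw [show a * b - p * q = (a - p) * (b - q) + (a - p) * q + p * (b - q) by ring]
      calc _ ≤ (K * ε * r ^ d) * (M * ε * r ^ e) + (K * ε * r ^ d) * (M * r ^ e) +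
            (K * r ^ d) * (M * ε * r ^ e) := by
            refine weightedNorm.add_le.trans (add_le_add (weightedNorm.add_le.trans
              (add_le_add ?_ ?_)) ?_) <;>
            exact weightedNorm.mul_le.trans (by gcongr)
        _ = (ε + 2) * (K * M) * ε * r ^ (d + e) := by ring
        _ ≤ (1 + 2) * (K * M) * ε * r ^ (d + e) := by gcongr
        _ = _ := by norm_num
    · rw [mul]
      calc _ ≤ (K * ε * r ^ d) * (M * ε * r ^ e) + (K * ε ^ 2 * r ^ d) * (M * r ^ e) +
            (K * r ^ d) * (M * ε ^ 2 * r ^ e) := by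
            refine weightedNorm.add_le.trans (add_le_add (weightedNorm.add_le.trans
              (add_le_add ?_ ?_)) ?_) <;>
            exact weightedNorm.mul_le.trans (by gcongr)
        _ = _ := by ring
  · refine ⟨0, by simp, fun r ε u hε hu => ?_⟩
    rw [zero]
    simp [weightedNorm.zero]
  · rintro d p q ⟨K, hK, h⟩ ⟨M, hM, k⟩
    refine ⟨K + M, ENNReal.add_ne_top.mpr ⟨hK, hM⟩, fun r ε u hε hu => ?_⟩
    obtain ⟨h₁, h₂, h₃⟩ := h r ε u hε hu
    obtain ⟨k₁, k₂, k₃⟩ := k r ε u hε hu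
    rw [map_add, MvPolynomial.coe_add, add_sub_add_comm, add]
    simp only [add_mul]
    exact ⟨weightedNorm.add_le.trans (add_le_add h₁ k₁),
      weightedNorm.add_le.trans (add_le_add h₂ k₂), weightedNorm.add_le.trans (add_le_add h₃ k₃)⟩

end taylorRemainder

/-! ### Division by the partial derivatives -/

/-- Any exponent of weight larger than `d` dominates one from a finite set of such exponents. -/
theorem exists_finset_exponents_le {n : ℕ} (w : Fin n → ℕ) (hw : ∀ i, 0 < w i) (d : ℕ) :
    ∃ G : Finset (Fin n →₀ ℕ), (∀ γ ∈ G, d < Finsupp.weight w γ) ∧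
      ∀ α, d < Finsupp.weight w α → ∃ γ ∈ G, γ ≤ α := by
  -- Above weight `d + ∑ w i`, an exponent can be lowered in any variable it contains and still have
  -- weight above `d`.
  have hfin := Finsupp.finite_of_nat_weight_le w (fun i => (hw i).ne') (d + ∑ i, w i)
  refine ⟨hfin.toFinset.filter fun α => d < Finsupp.weight w α, by simp, fun α hα => ?_⟩
  obtain ⟨k, hk⟩ : ∃ k, Finsupp.weight w α = k := ⟨_, rfl⟩
  induction k using Nat.strong_induction_on generalizing α with
  | _ k ih =>
    by_cases h : Finsupp.weight w α ≤ d + ∑ i, w i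
    · exact ⟨α, by simp [h, hα], le_rfl⟩
    have hne : α ≠ 0 := by
      rintro rfl
      simp at hα
    obtain ⟨i, hi⟩ := Finsupp.ne_iff.mp hne
    have hle : Finsupp.single i 1 ≤ α := by
      rw [Finsupp.single_le_iff]
      exact Nat.one_le_iff_ne_zero.mpr hi
    have hsum : Finsupp.weight w (α - Finsupp.single i 1) + w i = Finsupp.weight w α := by
      conv_rhs => rw [← tsub_add_cancel_of_le hle, map_add, Finsupp.weight_single, one_smul]
    have hwi : w i ≤ ∑ i, w i := Finset.single_le_sum (fun _ _ => Nat.zero_le _) (Finset.mem_univ i)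
    have := hw i
    obtain ⟨γ, hγ, hγ'⟩ := ih _ (by omega) (α - Finsupp.single i 1) (by omega) rfl
    exact ⟨γ, hγ, hγ'.trans tsub_le_self⟩

/-- The monomials of `g` to which `c` assigns the divisor `x^γ`, divided by `x^γ`. -/
noncomputable def monomialQuotient {n : ℕ} (c : (Fin n →₀ ℕ) → Fin n →₀ ℕ) (γ : Fin n →₀ ℕ) :
    MvPowerSeries (Fin n) ℂ →ₗ[ℂ] MvPowerSeries (Fin n) ℂ where
  toFun g β := if c (β + γ) = γ then MvPowerSeries.coeff (β + γ) g else 0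
  map_add' f g := by
    ext β
    change (if c (β + γ) = γ then MvPowerSeries.coeff (β + γ) (f + g) else 0) =
      (if c (β + γ) = γ then MvPowerSeries.coeff (β + γ) f else 0) +
        if c (β + γ) = γ then MvPowerSeries.coeff (β + γ) g else 0
    split_ifs <;> simp
  map_smul' a f := by
    ext β
    change (if c (β + γ) = γ then MvPowerSeries.coeff (β + γ) (a • f) else 0) =
      a * if c (β + γ) = γ then MvPowerSeries.coeff (β + γ) f else 0
    split_ifs <;> simp

namespace monomialQuotient

variable {n : ℕ} {w : Fin n → ℕ} {c : (Fin n →₀ ℕ) → Fin n →₀ ℕ} {γ : Fin n →₀ ℕ}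
  {g : MvPowerSeries (Fin n) ℂ}

theorem coeff (β : Fin n →₀ ℕ) : MvPowerSeries.coeff β (monomialQuotient c γ g) =
    if c (β + γ) = γ then MvPowerSeries.coeff (β + γ) g else 0 := rfl

/-- The map `c` attributes each exponent of weight above `d` to exactly one divisor in `G`, so the
terms of `g` are distributed without overlap. -/
theorem sum_monomial_mul {d : ℕ} {G : Finset (Fin n →₀ ℕ)}
    (hc : ∀ α, d < Finsupp.weight w α → c α ∈ G ∧ c α ≤ α) (hg : VanishesBelow w (d + 1) g) :
    ∑ γ ∈ G, MvPowerSeries.monomial γ 1 * monomialQuotient c γ g = g := by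
  classical
  ext α
  rw [map_sum]
  have h (γ : Fin n →₀ ℕ) :
      MvPowerSeries.coeff α (MvPowerSeries.monomial γ 1 * monomialQuotient c γ g) =
        if γ ≤ α ∧ c α = γ then MvPowerSeries.coeff α g else 0 := by
    rw [MvPowerSeries.coeff_monomial_mul]
    by_cases hγ : γ ≤ α
    · rw [if_pos hγ, one_mul, coeff, tsub_add_cancel_of_le hγ]
      simp [hγ]
    · simp [hγ]
  simp_rw [h]
  rcases le_or_gt (Finsupp.weight w α) d with hα | hα
  · rw [hg α (by omega)]
    simp
  · obtain ⟨h₁, h₂⟩ := hc α hα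
    rw [Finset.sum_eq_single (c α)]
    · simp [h₂]
    · intro γ _ hγ
      rw [if_neg fun h => hγ h.2.symm]
    · exact fun h => absurd h₁ h

theorem weightedNorm_le (r : ℝ≥0∞) :
    r ^ Finsupp.weight w γ * weightedNorm w r (monomialQuotient c γ g) ≤ weightedNorm w r g := by
  rw [weightedNorm, ← ENNReal.tsum_mul_left]
  calc _ ≤ ∑' β, (fun α => ‖MvPowerSeries.coeff α g‖ₑ * r ^ Finsupp.weight w α) (β + γ) := by
        refine ENNReal.tsum_le_tsum fun β => ?_
        dsimp only
        rw [coeff, map_add, pow_add]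
        split_ifs
        · exact le_of_eq (by ring)
        · simp
    _ ≤ _ := ENNReal.tsum_comp_le_tsum_of_injective (add_left_injective γ) _

end monomialQuotient

/-- A monomial in the Jacobian ideal of a weighted homogeneous polynomial is a combination of the
partial derivatives with weighted homogeneous coefficients. -/
theorem exists_homogeneous_jacobian_combination {n : ℕ} {w : Fin n → ℕ} {d : ℕ}
    {p : MvPolynomial (Fin n) ℂ} (hp : p.IsWeightedHomogeneous w d) {γ : Fin n →₀ ℕ}
    (hγ : MvPolynomial.monomial γ 1 ∈ Ideal.span (Set.range fun i => MvPolynomial.pderiv i p)) :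
    ∃ q : Fin n → MvPolynomial (Fin n) ℂ,
      (∀ i β, MvPolynomial.coeff β (q i) ≠ 0 →
        Finsupp.weight w β + d = Finsupp.weight w γ + w i) ∧
      ∑ i, q i * MvPolynomial.pderiv i p = MvPolynomial.monomial γ 1 := by
  classical
  obtain ⟨q, hq⟩ := (Submodule.mem_span_range_iff_exists_fun _).mp hγ
  simp only [smul_eq_mul] at hq
  have hder {i : Fin n} {η : Fin n →₀ ℕ} (h : MvPolynomial.coeff η (MvPolynomial.pderiv i p) ≠ 0) :
      Finsupp.weight w η + w i = d := by
    rw [MvPolynomial.coeff_pderiv] at h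
    have := hp (left_ne_zero_of_mul h)
    rwa [map_add, Finsupp.weight_single, one_smul] at this
  -- Only the terms of weight `weight γ + w i - d` are kept, written additively to avoid truncated
  -- subtraction. Since the partial derivatives are homogeneous, the other terms contribute nothing
  -- in the weight of `γ`, and the kept ones nothing elsewhere.
  let q' : Fin n → MvPolynomial (Fin n) ℂ := fun i =>
    ∑ β ∈ (q i).support with Finsupp.weight w β + d = Finsupp.weight w γ + w i,
      MvPolynomial.monomial β (MvPolynomial.coeff β (q i))
  have hq' (i) (β) : MvPolynomial.coeff β (q' i) =
      if Finsupp.weight w β + d = Finsupp.weight w γ + w i then MvPolynomial.coeff β (q i)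
        else 0 := by
    rw [MvPolynomial.coeff_sum]
    simp only [MvPolynomial.coeff_monomial, Finset.sum_ite_eq', Finset.mem_filter,
      MvPolynomial.mem_support_iff]
    split_ifs <;> simp_all
  refine ⟨q', fun i β h => ?_, ?_⟩
  · rw [hq'] at h
    by_contra hne
    simp [hne] at h
  · ext δ
    by_cases hδ : Finsupp.weight w δ = Finsupp.weight w γ
    · rw [← hq, MvPolynomial.coeff_sum, MvPolynomial.coeff_sum]
      refine Finset.sum_congr rfl fun i _ => ?_
      rw [MvPolynomial.coeff_mul, MvPolynomial.coeff_mul]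
      refine Finset.sum_congr rfl fun x hx => ?_
      by_cases h : MvPolynomial.coeff x.2 (MvPolynomial.pderiv i p) = 0
      · rw [h, mul_zero, mul_zero]
      · have h₁ := hder h
        rw [← Finset.HasAntidiagonal.mem_antidiagonal.mp hx, map_add] at hδ
        rw [hq', if_pos (by omega)]
    · rw [MvPolynomial.coeff_monomial, if_neg (by rintro rfl; exact hδ rfl),
        MvPolynomial.coeff_sum]
      refine Finset.sum_eq_zero fun i _ => ?_
      rw [MvPolynomial.coeff_mul]
      refine Finset.sum_eq_zero fun x hx => ?_
      by_cases h : MvPolynomial.coeff x.2 (MvPolynomial.pderiv i p) = 0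
      · rw [h, mul_zero]
      · have h₁ := hder h
        rw [← Finset.HasAntidiagonal.mem_antidiagonal.mp hx, map_add] at hδ
        rw [hq', if_neg (by omega), zero_mul]

/-- Linear division by the partial derivatives of a weighted homogeneous polynomial, with bounds
on orders and norms, if the Jacobian ideal contains all monomials of weight larger than `d`. -/
theorem exists_jacobian_division {n : ℕ} {w : Fin n → ℕ} (hw : ∀ i, 0 < w i) {d : ℕ}
    {p : MvPolynomial (Fin n) ℂ} (hp : p.IsWeightedHomogeneous w d)
    (hJ : ∀ γ, d < Finsupp.weight w γ →
      MvPolynomial.monomial γ 1 ∈ Ideal.span (Set.range fun i => MvPolynomial.pderiv i p)) :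
    ∃ L : Fin n → MvPowerSeries (Fin n) ℂ →ₗ[ℂ] MvPowerSeries (Fin n) ℂ,
      (∀ g, VanishesBelow w (d + 1) g →
        ∑ i, L i g * (MvPolynomial.pderiv i p : MvPolynomial (Fin n) ℂ) = g) ∧
      (∀ g i m, VanishesBelow w (d + m) g → VanishesBelow w (w i + m) (L i g)) ∧
      ∃ K ≠ ∞, ∀ r g i, weightedNorm w r (L i g) * r ^ d ≤ K * r ^ w i * weightedNorm w r g := by
  classical
  obtain ⟨G, hG, hGle⟩ := exists_finset_exponents_le w hw d
  have hchoice : ∀ α, ∃ γ, d < Finsupp.weight w α → γ ∈ G ∧ γ ≤ α := fun α => by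
    by_cases h : d < Finsupp.weight w α
    · obtain ⟨γ, h₁, h₂⟩ := hGle α h
      exact ⟨γ, fun _ => ⟨h₁, h₂⟩⟩
    · exact ⟨0, fun h' => absurd h' h⟩
  choose c hc using hchoice
  have hq' : ∀ γ, ∃ q : Fin n → MvPolynomial (Fin n) ℂ, γ ∈ G →
      (∀ i β, MvPolynomial.coeff β (q i) ≠ 0 →
        Finsupp.weight w β + d = Finsupp.weight w γ + w i) ∧
      ∑ i, q i * MvPolynomial.pderiv i p = MvPolynomial.monomial γ 1 := fun γ => by
    by_cases h : γ ∈ G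
    · obtain ⟨q, hq⟩ := exists_homogeneous_jacobian_combination hp (hJ γ (hG γ h))
      exact ⟨q, fun _ => hq⟩
    · exact ⟨0, fun h' => absurd h' h⟩
  choose q hq using hq'
  -- By homogeneity the norm of `q γ i` at radius `r` is its norm at radius `1` times `r` to the
  -- power `weight γ + w i - d`; the factor `r ^ d` avoids a negative exponent.
  have hqnorm (γ) (hγ : γ ∈ G) (i) (r : ℝ≥0∞) :
      weightedNorm w r (q γ i : MvPowerSeries (Fin n) ℂ) * r ^ d =
        weightedNorm w 1 (q γ i : MvPowerSeries (Fin n) ℂ) *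
          (r ^ Finsupp.weight w γ * r ^ w i) := by
    rw [weightedNorm, weightedNorm, ← ENNReal.tsum_mul_right, ← ENNReal.tsum_mul_right]
    refine tsum_congr fun β => ?_
    by_cases h : MvPolynomial.coeff β (q γ i) = 0
    · simp [h]
    · rw [one_pow, mul_one, mul_assoc, ← pow_add, ← pow_add, (hq γ hγ).1 i β h]
  -- In `g = ∑ x^γ g_γ`, each of the finitely many `x^γ` is replaced by `∑ q γ i * ∂_i p`.
  let L : Fin n → MvPowerSeries (Fin n) ℂ →ₗ[ℂ] MvPowerSeries (Fin n) ℂ := fun i =>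
    ∑ γ ∈ G, LinearMap.mulLeft ℂ (q γ i : MvPowerSeries (Fin n) ℂ) ∘ₗ monomialQuotient c γ
  have hL (i) (g) : L i g = ∑ γ ∈ G, (q γ i : MvPowerSeries (Fin n) ℂ) *
      monomialQuotient c γ g := by
    simp [L, LinearMap.sum_apply]
  refine ⟨L, fun g hg => ?_, fun g i m hg => ?_, ∑ γ ∈ G, ∑ i,
    weightedNorm w 1 (q γ i : MvPowerSeries (Fin n) ℂ), ?_, fun r g i => ?_⟩
  · conv_rhs => rw [← monomialQuotient.sum_monomial_mul hc hg]
    simp_rw [hL, Finset.sum_mul]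
    rw [Finset.sum_comm]
    refine Finset.sum_congr rfl fun γ hγ => ?_
    have h := congrArg (MvPolynomial.coeToMvPowerSeries.ringHom (σ := Fin n) (R := ℂ)) (hq γ hγ).2
    simp only [map_sum, map_mul, MvPolynomial.coeToMvPowerSeries.ringHom_apply,
      MvPolynomial.coe_monomial] at h
    rw [← h, Finset.sum_mul]
    exact Finset.sum_congr rfl fun i _ => by ring
  · rw [hL]
    refine VanishesBelow.sum fun γ hγ α hα => ?_
    rw [MvPowerSeries.coeff_mul]
    refine Finset.sum_eq_zero fun x hx => ?_
    rw [← Finset.HasAntidiagonal.mem_antidiagonal.mp hx, map_add] at hα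
    by_cases h : MvPolynomial.coeff x.1 (q γ i) = 0
    · rw [MvPolynomial.coeff_coe, h, zero_mul]
    · have h₁ := (hq γ hγ).1 i x.1 h
      rw [monomialQuotient.coeff]
      split_ifs
      · rw [hg _ (by rw [map_add]; omega), mul_zero]
      · rw [mul_zero]
  · exact ENNReal.sum_ne_top.mpr fun γ _ => ENNReal.sum_ne_top.mpr fun i _ =>
      weightedNorm.coe_ne_top _ ENNReal.one_ne_top
  · rw [hL]
    calc _ ≤ (∑ γ ∈ G, weightedNorm w r (q γ i : MvPowerSeries (Fin n) ℂ) *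
            weightedNorm w r (monomialQuotient c γ g)) * r ^ d := by
          gcongr
          exact (weightedNorm.sum_le _ _).trans (Finset.sum_le_sum fun γ _ => weightedNorm.mul_le)
      _ = ∑ γ ∈ G, weightedNorm w 1 (q γ i : MvPowerSeries (Fin n) ℂ) * r ^ w i *
            (r ^ Finsupp.weight w γ * weightedNorm w r (monomialQuotient c γ g)) := by
          rw [Finset.sum_mul]
          refine Finset.sum_congr rfl fun γ hγ => ?_
          rw [mul_right_comm, hqnorm γ hγ]
          ring
      _ ≤ ∑ γ ∈ G, (∑ i, weightedNorm w 1 (q γ i : MvPowerSeries (Fin n) ℂ)) * r ^ w i *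
            weightedNorm w r g := by
          gcongr with γ hγ
          · exact Finset.single_le_sum
              (f := fun i => weightedNorm w 1 (q γ i : MvPowerSeries (Fin n) ℂ))
              (fun _ _ => zero_le) (Finset.mem_univ i)
          · exact monomialQuotient.weightedNorm_le r
      _ = _ := by rw [Finset.sum_mul, Finset.sum_mul]

/-! ### Solving `p(x + u) = p + h` -/

theorem ENNReal.exists_ne_zero_le_mul_le {A δ s : ℝ≥0∞} (hA : A ≠ ∞) (hδ : δ ≠ 0) (hs : s ≠ 0) :
    ∃ ε, ε ≠ 0 ∧ ε ≤ s ∧ A * ε ≤ δ := by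
  refine ⟨min s (δ / (A + 1)), ?_, min_le_left _ _, ?_⟩
  · rw [← pos_iff_ne_zero, lt_min_iff]
    exact ⟨pos_iff_ne_zero.mpr hs, ENNReal.div_pos hδ (by simp [hA])⟩
  · calc A * min s (δ / (A + 1)) ≤ (A + 1) * (δ / (A + 1)) := by
          gcongr
          · exact le_self_add
          · exact min_le_right _ _
      _ ≤ δ := ENNReal.mul_div_le

section

variable {n : ℕ} {w : Fin n → ℕ} {u v : Fin n → MvPowerSeries (Fin n) ℂ} {r s : ℝ≥0∞}

/-- A convergent perturbation, by terms of larger weight, of a weighted homogeneous polynomial is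
obtained by a convergent change of coordinates, if the Jacobian ideal contains all monomials of
larger weight. -/
theorem exists_aeval_shift_eq (hw : ∀ i, 0 < w i) {d : ℕ}
    {p : MvPolynomial (Fin n) ℂ} (hp : p.IsWeightedHomogeneous w d)
    (hJ : ∀ γ, d < Finsupp.weight w γ →
      MvPolynomial.monomial γ 1 ∈ Ideal.span (Set.range fun i => MvPolynomial.pderiv i p))
    {h : MvPowerSeries (Fin n) ℂ} (hh : VanishesBelow w (d + 1) h) (hs₀ : s ≠ 0) (hs : s ≠ ∞)
    (hN : weightedNorm w s h ≠ ∞) :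
    ∃ u : Fin n → MvPowerSeries (Fin n) ℂ, (∀ i, VanishesBelow w (w i + 1) (u i)) ∧
      (∃ r, r ≠ 0 ∧ r ≠ ∞ ∧ ∀ i, weightedNorm w r (u i) ≠ ∞) ∧
      MvPolynomial.aeval (shift u) p = p + h := by
  obtain ⟨L, hL, hLord, K, hK, hLK⟩ := exists_jacobian_division hw hp hJ
  obtain ⟨M, hM, hRM⟩ := taylorRemainder.exists_weightedNorm_le hp
  obtain ⟨H, hH, hhH⟩ := weightedNorm.exists_le_mul_pow hh hs₀ hs hN
  -- First `K * M * ε ≤ 1/2` controls the quadratic remainder, then `K * H * r ≤ ε/2` controls `h`;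
  -- together they keep `L (h - R(u))` in the ball of relative size `ε`.
  obtain ⟨ε, hε₀, hε₁, hε⟩ := ENNReal.exists_ne_zero_le_mul_le (A := K * M) (δ := 2⁻¹) (s := 1)
    (ENNReal.mul_ne_top hK hM) (by simp) one_ne_zero
  obtain ⟨r, hr₀, hrs, hr⟩ := ENNReal.exists_ne_zero_le_mul_le (A := K * H) (δ := 2⁻¹ * ε)
    (ENNReal.mul_ne_top hK hH) (mul_ne_zero (by simp) hε₀) hs₀
  have hr₁ : r ≠ ∞ := ne_top_of_le_ne_top hs hrs
  obtain ⟨u, hu, hfix, hbound⟩ := exists_fixedPoint_of_contracting (w := w) (r := r)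
    (B := fun i => ε * r ^ w i) (fun u i => L i (h - taylorRemainder u p))
    (fun u hu i => hLord _ i 1 (hh.sub (taylorRemainder.vanishesBelow hp hu)))
    (fun u v m hu hv huv i => by
      rw [← map_sub, sub_sub_sub_cancel_left]
      exact hLord _ i (m + 1) (taylorRemainder.vanishesBelow_sub hp hv hu fun i => by
        rw [← neg_sub]
        exact (huv i).neg))
    (fun u hu hb i => by
      have h₁ : weightedNorm w r (L i (h - taylorRemainder u p)) * r ^ d ≤
          (ε * r ^ w i) * r ^ d := calc
        _ ≤ K * r ^ w i * (H * r ^ (d + 1) + M * ε ^ 2 * r ^ d) := by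
            refine (hLK r _ i).trans ?_
            gcongr
            exact weightedNorm.sub_le.trans (add_le_add (hhH r hrs) (hRM r ε u hε₁ hb))
        _ = (K * H * r + K * M * ε * ε) * r ^ w i * r ^ d := by ring
        _ ≤ (2⁻¹ * ε + 2⁻¹ * ε) * r ^ w i * r ^ d := by gcongr
        _ = _ := by rw [← add_mul, ENNReal.inv_two_add_inv_two, one_mul]
      exact (ENNReal.mul_le_mul_iff_left (pow_ne_zero _ hr₀) (ENNReal.pow_ne_top hr₁)).mp h₁)
  refine ⟨u, hu, ⟨r, hr₀, hr₁, fun i => ne_top_of_le_ne_top (ENNReal.mul_ne_top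
    (ne_top_of_le_ne_top ENNReal.one_ne_top hε₁) (ENNReal.pow_ne_top hr₁)) (hbound i)⟩, ?_⟩
  -- Division applied at the fixed point gives `∑ u i * ∂_i p = h - R(u)`, which is the desired
  -- equation by the definition of `R`.
  have hsum := hL _ (hh.sub (taylorRemainder.vanishesBelow hp hu))
  have hui (i) : L i (h - taylorRemainder u p) = u i := congrFun hfix i
  simp_rw [hui] at hsum
  rw [taylorRemainder] at hsum
  linear_combination hsum

/-! ### Inversion of coordinate changes and automorphisms -/

theorem hasSubst_shift (hu : ∀ i, VanishesBelow w (w i + 1) (u i)) :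
    MvPowerSeries.HasSubst (shift u) :=
  MvPowerSeries.hasSubst_of_constantCoeff_zero fun i => by
    rw [shift, map_add, (hu i).constantCoeff_eq_zero, MvPowerSeries.constantCoeff_X, add_zero]

theorem vanishesBelow_shift (hu : ∀ i, VanishesBelow w (w i + 1) (u i)) (i : Fin n) :
    VanishesBelow w (w i) (shift u i) :=
  (VanishesBelow.X i).add ((hu i).mono (by omega))

/-- The polynomial estimate applied to each monomial of `g`: those of weight below `d` are absent,
and the others change only at order at least `d + m`. -/
theorem VanishesBelow.subst_shift_sub {d m : ℕ} {g : MvPowerSeries (Fin n) ℂ}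
    (hg : VanishesBelow w d g) (hu : ∀ i, VanishesBelow w (w i + 1) (u i))
    (hv : ∀ i, VanishesBelow w (w i + 1) (v i)) (huv : ∀ i, VanishesBelow w (w i + m) (u i - v i)) :
    VanishesBelow w (d + m) (g.subst (shift u) - g.subst (shift v)) := fun β hβ => by
  rw [map_sub, MvPowerSeries.coeff_subst (hasSubst_shift hu),
    MvPowerSeries.coeff_subst (hasSubst_shift hv), sub_eq_zero]
  refine finsum_congr fun α => ?_
  by_cases hα : Finsupp.weight w α < d
  · rw [hg α hα, zero_smul, zero_smul]
  congr 1
  have h := (MvPolynomial.isWeightedHomogeneous_monomial w α (1 : ℂ)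
    rfl).vanishesBelow_aeval_sub_aeval (vanishesBelow_shift hu) (vanishesBelow_shift hv)
    (m := m) (fun i => by
      rw [shift, shift, add_sub_add_left_eq_sub]
      exact huv i) β (by omega)
  rwa [MvPolynomial.aeval_monomial, MvPolynomial.aeval_monomial, map_one, one_mul, one_mul,
    map_sub, sub_eq_zero] at h

theorem VanishesBelow.subst_shift {d : ℕ} {g : MvPowerSeries (Fin n) ℂ}
    (hg : VanishesBelow w d g) (hu : ∀ i, VanishesBelow w (w i + 1) (u i)) :
    VanishesBelow w d (g.subst (shift u)) := fun β hβ => by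
  rw [MvPowerSeries.coeff_subst (hasSubst_shift hu)]
  refine finsum_eq_zero_of_forall_eq_zero fun α => ?_
  by_cases hα : Finsupp.weight w α < d
  · rw [hg α hα, zero_smul]
  have h := (MvPolynomial.isWeightedHomogeneous_monomial w α (1 : ℂ)
    rfl).vanishesBelow_aeval (vanishesBelow_shift hu) β (by omega)
  rw [MvPolynomial.aeval_monomial, map_one, one_mul] at h
  rw [h, smul_zero]

/-- Adding `u i` at most doubles the bound, and `2 ≤ 2 ^ w i` for a positive weight. Thus the shift
costs no more than doubling the radius in `weightedNorm.subst_le`. -/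
theorem weightedNorm_shift_le (hw : ∀ i, 0 < w i) {i : Fin n}
    (hu : weightedNorm w r (u i) ≤ r ^ w i) : weightedNorm w r (shift u i) ≤ (2 * r) ^ w i :=
  calc weightedNorm w r (shift u i) ≤ r ^ w i + r ^ w i :=
        weightedNorm.add_le.trans (add_le_add (weightedNorm.X i).le hu)
    _ = 2 ^ 1 * r ^ w i := by ring
    _ ≤ 2 ^ w i * r ^ w i := by
        gcongr
        · norm_num
        · exact hw i
    _ = _ := (mul_pow _ _ _).symm

/-- For a family `u` of order larger than the weights, the norm of `u i` is at most
a constant multiple of `r ^ (w i + 1)`. -/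
theorem exists_weightedNorm_le_mul_of_vanishesBelow
    (hu : ∀ i, VanishesBelow w (w i + 1) (u i)) (hs₀ : s ≠ 0) (hs : s ≠ ∞) (hN : ∀ i, weightedNorm w s (u i) ≠ ∞) :
    ∃ K ≠ ∞, ∀ r ≤ s, ∀ i, weightedNorm w r (u i) ≤ K * r * r ^ w i := by
  choose K hK h using fun i => weightedNorm.exists_le_mul_pow (hu i) hs₀ hs (hN i)
  refine ⟨∑ i, K i, ENNReal.sum_ne_top.mpr fun i _ => hK i, fun r hr i => (h i r hr).trans ?_⟩
  rw [pow_succ', ← mul_assoc]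
  gcongr
  exact Finset.single_le_sum (fun _ _ => zero_le) (Finset.mem_univ i)

/-- A convergent change of coordinates `x_i ↦ x_i + u_i` has a convergent inverse. -/
theorem exists_inverse_shift (hw : ∀ i, 0 < w i) (hu : ∀ i, VanishesBelow w (w i + 1) (u i))
    (hs₀ : s ≠ 0) (hs : s ≠ ∞) (hN : ∀ i, weightedNorm w s (u i) ≠ ∞) :
    ∃ v : Fin n → MvPowerSeries (Fin n) ℂ, (∀ i, VanishesBelow w (w i + 1) (v i)) ∧
      (∃ r, r ≠ 0 ∧ r ≠ ∞ ∧ ∀ i, weightedNorm w r (v i) ≠ ∞) ∧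
      ∀ i, v i + (u i).subst (shift v) = 0 := by
  obtain ⟨K, hK, hKu⟩ := exists_weightedNorm_le_mul_of_vanishesBelow hu hs₀ hs hN
  obtain ⟨r, hr₀, hrs, hr⟩ := ENNReal.exists_ne_zero_le_mul_le (A := K * 2 * ∑ i, 2 ^ w i)
    (δ := 1) (s := s / 2) (ENNReal.mul_ne_top (ENNReal.mul_ne_top hK (by simp))
    (ENNReal.sum_ne_top.mpr fun i _ => by simp)) one_ne_zero
    (ENNReal.div_ne_zero.mpr ⟨hs₀, by simp⟩)
  have hr₁ : r ≠ ∞ := ne_top_of_le_ne_top (ENNReal.div_ne_top hs (by simp)) hrs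
  have h2r : 2 * r ≤ s := by
    rw [mul_comm]
    exact (ENNReal.le_div_iff_mul_le (by simp) (by simp)).mp hrs
  -- The relation `(x + u)(x + v) = x` reads `v = -u(x + v)`, and the right-hand side contracts
  -- because `u i` has order above `w i`. The choice `r ≤ s / 2` keeps the doubled radius where `u`
  -- is controlled.
  obtain ⟨v, hv, hfix, hbound⟩ := exists_fixedPoint_of_contracting (w := w) (r := r)
    (B := fun i => r ^ w i) (fun v i => -(u i).subst (shift v))
    (fun v hv i => ((hu i).subst_shift hv).neg)
    (fun v v' m hv hv' hvv i => by
      rw [← neg_sub', add_right_comm]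
      exact ((hu i).subst_shift_sub hv hv' hvv).neg)
    (fun v hv hb i => by
      rw [weightedNorm.neg]
      calc _ ≤ weightedNorm w (2 * r) (u i) :=
            weightedNorm.subst_le (hasSubst_shift hv) fun i => weightedNorm_shift_le hw (hb i)
        _ ≤ K * (2 * r) * (2 * r) ^ w i := hKu _ h2r i
        _ = K * 2 * 2 ^ w i * r * r ^ w i := by rw [mul_pow]; ring
        _ ≤ K * 2 * (∑ i, 2 ^ w i) * r * r ^ w i := by
            gcongr
            exact Finset.single_le_sum (f := fun i => (2 : ℝ≥0∞) ^ w i)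
              (fun _ _ => zero_le) (Finset.mem_univ i)
        _ ≤ 1 * r ^ w i := by gcongr
        _ = r ^ w i := one_mul _)
  refine ⟨v, hv, ⟨r, hr₀, hr₁, fun i => ne_top_of_le_ne_top (ENNReal.pow_ne_top hr₁) (hbound i)⟩,
    fun i => ?_⟩
  have hvi : -(u i).subst (shift v) = v i := congrFun hfix i
  rw [← hvi]
  exact neg_add_cancel _

theorem exists_weightedNorm_subst_shift_ne_top (hw : ∀ i, 0 < w i)
    (hu : ∀ i, VanishesBelow w (w i + 1) (u i)) (hs₀ : s ≠ 0) (hs : s ≠ ∞)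
    (hN : ∀ i, weightedNorm w s (u i) ≠ ∞) {t : ℝ≥0∞} (ht₀ : t ≠ 0) {g : MvPowerSeries (Fin n) ℂ}
    (hg : weightedNorm w t g ≠ ∞) :
    ∃ r, r ≠ 0 ∧ r ≠ ∞ ∧ weightedNorm w r (g.subst (shift u)) ≠ ∞ := by
  obtain ⟨K, hK, hKu⟩ := exists_weightedNorm_le_mul_of_vanishesBelow hu hs₀ hs hN
  obtain ⟨r, hr₀, hrs, hr⟩ := ENNReal.exists_ne_zero_le_mul_le (A := K) (δ := 1)
    (s := min s (t / 2)) hK one_ne_zero (by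
      rw [← pos_iff_ne_zero, lt_min_iff]
      exact ⟨pos_iff_ne_zero.mpr hs₀, ENNReal.div_pos ht₀ (by simp)⟩)
  have h2r : 2 * r ≤ t := by
    rw [mul_comm]
    exact (ENNReal.le_div_iff_mul_le (by simp) (by simp)).mp (hrs.trans (min_le_right _ _))
  refine ⟨r, hr₀, ne_top_of_le_ne_top hs (hrs.trans (min_le_left _ _)),
    ne_top_of_le_ne_top hg ((weightedNorm.subst_le (hasSubst_shift hu) fun i =>
      weightedNorm_shift_le hw ?_).trans (weightedNorm.mono h2r))⟩
  calc _ ≤ K * r * r ^ w i := hKu r (hrs.trans (min_le_left _ _)) i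
    _ ≤ 1 * r ^ w i := by gcongr
    _ = r ^ w i := one_mul _

theorem subst_shift_subst_shift (hu : ∀ i, VanishesBelow w (w i + 1) (u i))
    (hv : ∀ i, VanishesBelow w (w i + 1) (v i)) (huv : ∀ i, v i + (u i).subst (shift v) = 0)
    (g : MvPowerSeries (Fin n) ℂ) : (g.subst (shift u)).subst (shift v) = g := by
  rw [MvPowerSeries.subst_comp_subst_apply (hasSubst_shift hu) (hasSubst_shift hv)]
  have : (fun i => (shift u i).subst (shift v)) =
      (MvPowerSeries.X : Fin n → MvPowerSeries (Fin n) ℂ) := by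
    ext1 i
    rw [shift, MvPowerSeries.subst_add (hasSubst_shift hv),
      MvPowerSeries.subst_X (hasSubst_shift hv), shift, add_assoc, huv, add_zero]
  rw [this, MvPowerSeries.subst_self, id]

/-- Positive weights give `degree α ≤ weight α ≤ (∑ w i) * degree α`. Hence, for radii at most `1`,
each norm dominates the other, at the price of replacing `t` by `t ^ ∑ w i` in one direction. -/
theorem isConvergentSeries_iff_weightedNorm_ne_top (hw : ∀ i, 0 < w i)
    {f : MvPowerSeries (Fin n) ℂ} :
    IsConvergentSeries f ↔ ∃ r, r ≠ 0 ∧ r ≠ ∞ ∧ weightedNorm w r f ≠ ∞ := by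
  constructor
  · rintro ⟨s, hs, hf⟩
    have ht : 0 < min s 1 := lt_min hs one_pos
    have hf' := IsConvergentSeries.summable_of_le hf ht (min_le_left _ _)
    set t := min s 1
    refine ⟨ENNReal.ofReal t, by simpa using ht, ENNReal.ofReal_ne_top,
      ne_top_of_le_ne_top hf'.tsum_ofReal_ne_top (ENNReal.tsum_le_tsum fun α => ?_)⟩
    rw [ENNReal.ofReal_mul (norm_nonneg _), ofReal_norm, ENNReal.ofReal_pow ht.le]
    gcongr 1
    refine pow_le_pow_right_of_le_one' ?_ ?_
    · rw [ENNReal.ofReal_le_one]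
      exact min_le_right _ _
    · rw [Finsupp.degree_eq_sum, Finsupp.weight_eq_sum]
      exact Finset.sum_le_sum fun i _ => Nat.le_mul_of_pos_right _ (hw i)
  · rintro ⟨r, hr₀, hr₁, hf⟩
    set t := min r 1
    have ht₁ : t ≤ 1 := min_le_right _ _
    have htop : t ≠ ∞ := ne_top_of_le_ne_top ENNReal.one_ne_top ht₁
    have ht₀ : t ≠ 0 := by
      rw [← pos_iff_ne_zero, lt_min_iff]
      exact ⟨pos_iff_ne_zero.mpr hr₀, one_pos⟩
    have hf' : weightedNorm w t f ≠ ∞ :=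
      ne_top_of_le_ne_top hf (weightedNorm.mono (min_le_left _ _))
    have htR : 0 < t.toReal := ENNReal.toReal_pos ht₀ htop
    refine ⟨t.toReal ^ (∑ i, w i), pow_pos htR _,
      Summable.of_nonneg_of_le (fun α => by positivity) (fun α => ?_)
      (ENNReal.summable_toReal hf')⟩
    rw [ENNReal.toReal_mul, toReal_enorm, ENNReal.toReal_pow, ← pow_mul]
    refine mul_le_mul_of_nonneg_left (pow_le_pow_of_le_one htR.le ?_ ?_) (norm_nonneg _)
    · exact ENNReal.toReal_le_of_le_ofReal zero_le_one (by simpa using ht₁)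
    · rw [Finsupp.degree_eq_sum, Finsupp.weight_eq_sum, Finset.mul_sum]
      refine Finset.sum_le_sum fun i _ => ?_
      rw [smul_eq_mul, mul_comm]
      exact Nat.mul_le_mul_right _
        (Finset.single_le_sum (fun _ _ => Nat.zero_le _) (Finset.mem_univ i))

/-- The endomorphism `x_i ↦ x_i + u_i` of the algebra of convergent power series. -/
noncomputable def shiftAlgHom (hw : ∀ i, 0 < w i) (hu : ∀ i, VanishesBelow w (w i + 1) (u i))
    (hN : ∃ s, s ≠ 0 ∧ s ≠ ∞ ∧ ∀ i, weightedNorm w s (u i) ≠ ∞) :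
    ConvergentSeries n →ₐ[ℂ] ConvergentSeries n :=
  ((MvPowerSeries.substAlgHom (R := ℂ) (hasSubst_shift hu)).comp
    (ConvergentSeries n).val).codRestrict (ConvergentSeries n) fun g => by
      obtain ⟨s, hs₀, hs, hN⟩ := hN
      obtain ⟨t, ht₀, -, ht⟩ := (isConvergentSeries_iff_weightedNorm_ne_top hw).mp g.2
      have := (isConvergentSeries_iff_weightedNorm_ne_top hw).mpr
        (exists_weightedNorm_subst_shift_ne_top hw hu hs₀ hs hN ht₀ ht)
      rwa [← MvPowerSeries.substAlgHom_apply (hasSubst_shift hu)] at this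

theorem coe_shiftAlgHom_apply (hw : ∀ i, 0 < w i) (hu : ∀ i, VanishesBelow w (w i + 1) (u i))
    (hN : ∃ s, s ≠ 0 ∧ s ≠ ∞ ∧ ∀ i, weightedNorm w s (u i) ≠ ∞) (g : ConvergentSeries n) :
    (shiftAlgHom hw hu hN g : MvPowerSeries (Fin n) ℂ) =
      (g : MvPowerSeries (Fin n) ℂ).subst (shift u) :=
  MvPowerSeries.substAlgHom_apply (hasSubst_shift hu) _

/-- A convergent power series whose part of least weight `d` is a polynomial `p` is transformed into
`p` by a weight-respecting automorphism, if the Jacobian ideal of `p` contains all monomials of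
weight larger than `d`. -/
theorem exists_weightRespecting_automorphism (hw : ∀ i, 0 < w i) {d : ℕ}
    {p : MvPolynomial (Fin n) ℂ} (hp : p.IsWeightedHomogeneous w d)
    (hJ : ∀ γ, d < Finsupp.weight w γ →
      MvPolynomial.monomial γ 1 ∈ Ideal.span (Set.range fun i => MvPolynomial.pderiv i p))
    (f : ConvergentSeries n) (hf : VanishesBelow w (d + 1) ((f : MvPowerSeries (Fin n) ℂ) - p)) :
    ∃ Ψ : ConvergentSeries n ≃ₐ[ℂ] ConvergentSeries n,
      IsWeightRespecting w Ψ ∧ (Ψ f : MvPowerSeries (Fin n) ℂ) = p := by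
  obtain ⟨s, hs₀, hs, hfs⟩ := (isConvergentSeries_iff_weightedNorm_ne_top hw).mp f.2
  obtain ⟨u, hu, hNu, hup⟩ := exists_aeval_shift_eq hw hp hJ hf hs₀ hs
    (ne_top_of_le_ne_top (ENNReal.add_ne_top.mpr ⟨hfs, weightedNorm.coe_ne_top p hs⟩)
      weightedNorm.sub_le)
  rw [add_sub_cancel, ← MvPowerSeries.subst_coe] at hup
  obtain ⟨v, hv, hNv, hvu⟩ := exists_inverse_shift hw hu hNu.choose_spec.1 hNu.choose_spec.2.1
    hNu.choose_spec.2.2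
  -- The fixed point yields an inverse on one side only. Inverting `v` in turn gives substitution by
  -- `v` an inverse on its other side, which must then agree with substitution by `u`; convergence
  -- of `u'` is therefore irrelevant.
  obtain ⟨u', hu', -, huv⟩ := exists_inverse_shift hw hv hNv.choose_spec.1 hNv.choose_spec.2.1
    hNv.choose_spec.2.2
  have hleft := subst_shift_subst_shift hu hv hvu
  have hright (g : MvPowerSeries (Fin n) ℂ) : (g.subst (shift v)).subst (shift u) = g := by
    have h := subst_shift_subst_shift hv hu' huv
    rw [← h ((g.subst (shift v)).subst (shift u)), hleft, h]
  -- Substitution by `x + u` takes `p` to `f`, so `Ψ` is substitution by `x + v`.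
  refine ⟨AlgEquiv.ofAlgHom (shiftAlgHom hw hv hNv) (shiftAlgHom hw hu hNu) ?_ ?_,
    fun i => ⟨?_, ?_⟩, ?_⟩
  · ext1 g
    refine Subtype.ext ?_
    simp only [AlgHom.comp_apply, coe_shiftAlgHom_apply, hleft, AlgHom.id_apply]
  · ext1 g
    refine Subtype.ext ?_
    simp only [AlgHom.comp_apply, coe_shiftAlgHom_apply, hright, AlgHom.id_apply]
  · rw [← VanishesBelow.iff_le_weightedOrder, AlgEquiv.ofAlgHom_apply, coe_shiftAlgHom_apply]
    exact (VanishesBelow.X i).subst_shift hv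
  · rw [← VanishesBelow.iff_le_weightedOrder, AlgEquiv.ofAlgHom_symm,
      AlgEquiv.ofAlgHom_apply, coe_shiftAlgHom_apply]
    exact (VanishesBelow.X i).subst_shift hu
  · rw [AlgEquiv.ofAlgHom_apply, coe_shiftAlgHom_apply, ← hup]
    exact hleft _

end

/-! ### Adding squares of further variables -/

/-- The polynomial `x_{m+1}^2 + … + x_n^2`. -/
noncomputable def squaresPolynomial (n m : ℕ) : MvPolynomial (Fin n) ℂ :=
  ∑ i : Fin n with m ≤ i.val, MvPolynomial.X i ^ 2

namespace squaresPolynomial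

variable {n m : ℕ}

theorem coe : (squaresPolynomial n m : MvPowerSeries (Fin n) ℂ) = ADENormalForm.squares n m := by
  rw [← MvPolynomial.coeToMvPowerSeries.ringHom_apply, squaresPolynomial, map_sum]
  simp [ADENormalForm.squares]

theorem coeff_eq_zero {α : Fin n →₀ ℕ} (hα : ∀ i : Fin n, m ≤ i.val → α i = 0) :
    MvPolynomial.coeff α (squaresPolynomial n m) = 0 := by
  classical
  rw [squaresPolynomial, MvPolynomial.coeff_sum]
  refine Finset.sum_eq_zero fun i hi => ?_
  rw [MvPolynomial.X_pow_eq_monomial, MvPolynomial.coeff_monomial, if_neg]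
  rintro rfl
  simpa using hα i (by simpa using hi)

theorem pderiv_of_lt {j : Fin n} (hj : j.val < m) :
    MvPolynomial.pderiv j (squaresPolynomial n m) = 0 := by
  rw [squaresPolynomial, map_sum]
  refine Finset.sum_eq_zero fun i hi => ?_
  have hij : i ≠ j := by
    rintro rfl
    simp at hi
    omega
  rw [MvPolynomial.pderiv_pow, MvPolynomial.pderiv_X_of_ne hij, mul_zero]

theorem pderiv_of_le {j : Fin n} (hj : m ≤ j.val) :
    MvPolynomial.pderiv j (squaresPolynomial n m) = 2 * MvPolynomial.X j := by
  rw [squaresPolynomial, map_sum, Finset.sum_eq_single j]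
  · simp
  · intro i _ hij
    rw [MvPolynomial.pderiv_pow, MvPolynomial.pderiv_X_of_ne hij, mul_zero]
  · simp [hj]

end squaresPolynomial

theorem Ideal.mem_of_natCast_mul_mem {n : ℕ} {I : Ideal (MvPolynomial (Fin n) ℂ)} {m : ℕ}
    (hm : m ≠ 0) {p : MvPolynomial (Fin n) ℂ} (h : (m : MvPolynomial (Fin n) ℂ) * p ∈ I) :
    p ∈ I := by
  have h' := I.mul_mem_left (MvPolynomial.C (m : ℂ)⁻¹) h
  rwa [← mul_assoc, ← map_natCast (MvPolynomial.C : ℂ →+* MvPolynomial (Fin n) ℂ),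
    ← MvPolynomial.C_mul, inv_mul_cancel₀ (by exact_mod_cast hm), MvPolynomial.C_1, one_mul] at h'

section

variable {n m : ℕ} {q : MvPolynomial (Fin n) ℂ}

/-- The derivative in `x_j` is `2 * x_j`, so the Jacobian ideal contains every squared variable, and
only monomials in the first `m` variables remain to be examined. -/
theorem monomial_mem_jacobian_add_squares
    (hq : ∀ i : Fin n, m ≤ i.val → MvPolynomial.pderiv i q = 0)
    {γ : Fin n →₀ ℕ} {j : Fin n} (hj : m ≤ j.val) (hγ : γ j ≠ 0) :
    MvPolynomial.monomial γ 1 ∈ Ideal.span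
      (Set.range fun i => MvPolynomial.pderiv i (q + squaresPolynomial n m)) := by
  have hX : MvPolynomial.X j ∈ Ideal.span
      (Set.range fun i => MvPolynomial.pderiv i (q + squaresPolynomial n m)) := by
    refine Ideal.mem_of_natCast_mul_mem (m := 2) two_ne_zero ?_
    have : ((2 : ℕ) : MvPolynomial (Fin n) ℂ) * MvPolynomial.X j =
        MvPolynomial.pderiv j (q + squaresPolynomial n m) := by
      rw [map_add, hq j hj, squaresPolynomial.pderiv_of_le hj, zero_add, Nat.cast_ofNat]
    rw [this]
    exact Ideal.subset_span ⟨j, rfl⟩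
  refine Ideal.mem_of_dvd _ ?_ hX
  rw [MvPolynomial.X_dvd_monomial]
  exact Or.inr hγ

theorem span_pderiv_le_jacobian_add_squares (I : Set (Fin n)) (hI : ∀ i ∈ I, i.val < m) :
    Ideal.span ((fun i => MvPolynomial.pderiv i q) '' I) ≤
      Ideal.span (Set.range fun i => MvPolynomial.pderiv i (q + squaresPolynomial n m)) := by
  rw [Ideal.span_le]
  rintro _ ⟨i, hi, rfl⟩
  refine Ideal.subset_span ⟨i, ?_⟩
  dsimp only
  rw [map_add, squaresPolynomial.pderiv_of_lt (hI i hi), add_zero]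

end

/-! ### Binomials in two variables -/

/-- The first coordinate of a space of dimension at least two. -/
def fstIndex {n : ℕ} (hn : 2 ≤ n) : Fin n := ⟨0, Nat.lt_of_lt_of_le Nat.zero_lt_two hn⟩

/-- The second coordinate of a space of dimension at least two. -/
def sndIndex {n : ℕ} (hn : 2 ≤ n) : Fin n := ⟨1, Nat.lt_of_lt_of_le Nat.one_lt_two hn⟩

section

variable {n : ℕ} (hn : 2 ≤ n)

theorem fstIndex_ne_sndIndex : fstIndex hn ≠ sndIndex hn := by
  simp [fstIndex, sndIndex]

/-- The exponent of the monomial `x_1^a x_2^b`. -/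
noncomputable def planeExponent (a b : ℕ) : Fin n →₀ ℕ :=
  Finsupp.single (fstIndex hn) a + Finsupp.single (sndIndex hn) b

/-- The monomial `x_1^a x_2^b`. -/
noncomputable def planeMonomial (a b : ℕ) : MvPolynomial (Fin n) ℂ :=
  MvPolynomial.X (fstIndex hn) ^ a * MvPolynomial.X (sndIndex hn) ^ b

theorem weight_planeExponent (w : Fin n → ℕ) (a b : ℕ) :
    Finsupp.weight w (planeExponent hn a b) = a * w (fstIndex hn) + b * w (sndIndex hn) := by
  rw [planeExponent, map_add, Finsupp.weight_single, Finsupp.weight_single, smul_eq_mul,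
    smul_eq_mul]

theorem monomial_planeExponent (a b : ℕ) :
    MvPolynomial.monomial (planeExponent hn a b) (1 : ℂ) = planeMonomial hn a b := by
  rw [planeMonomial, MvPolynomial.X_pow_eq_monomial, MvPolynomial.X_pow_eq_monomial,
    MvPolynomial.monomial_mul, one_mul, planeExponent]

theorem planeExponent_inj {a b a' b' : ℕ} :
    planeExponent hn a b = planeExponent hn a' b' ↔ a = a' ∧ b = b' := by
  have h := fstIndex_ne_sndIndex hn
  refine ⟨fun hab => ⟨?_, ?_⟩, by rintro ⟨rfl, rfl⟩; rfl⟩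
  · simpa [planeExponent, h, h.symm] using DFunLike.congr_fun hab (fstIndex hn)
  · simpa [planeExponent, h, h.symm] using DFunLike.congr_fun hab (sndIndex hn)

theorem ne_fstIndex_and_ne_sndIndex {i : Fin n} (hi : 2 ≤ i.val) :
    fstIndex hn ≠ i ∧ sndIndex hn ≠ i := by
  constructor
  all_goals
    rintro rfl
    simp [fstIndex, sndIndex] at hi

theorem planeExponent_apply_eq_zero (a b : ℕ) {i : Fin n} (hi : 2 ≤ i.val) :
    planeExponent hn a b i = 0 := by
  have h := ne_fstIndex_and_ne_sndIndex hn hi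
  simp [planeExponent, h.1.symm, h.2.symm]

theorem eq_planeExponent {γ : Fin n →₀ ℕ} (hγ : ∀ i : Fin n, 2 ≤ i.val → γ i = 0) :
    γ = planeExponent hn (γ (fstIndex hn)) (γ (sndIndex hn)) := by
  have hne := fstIndex_ne_sndIndex hn
  ext i
  by_cases h₁ : i = fstIndex hn
  · subst h₁
    simp [planeExponent, hne]
  by_cases h₂ : i = sndIndex hn
  · subst h₂
    simp [planeExponent, hne.symm]
  have h : 2 ≤ i.val := by
    simp only [fstIndex, sndIndex, Fin.ext_iff] at h₁ h₂
    omega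
  rw [hγ i h, planeExponent_apply_eq_zero hn _ _ h]

/-- At `a = 0` the truncated exponent `a - 1` is harmless, since its coefficient is zero. -/
theorem pderiv_fst_planeMonomial (a b : ℕ) :
    MvPolynomial.pderiv (fstIndex hn) (planeMonomial hn a b) =
      a * planeMonomial hn (a - 1) b := by
  have h := fstIndex_ne_sndIndex hn
  simp [planeMonomial, MvPolynomial.pderiv_X_of_ne h.symm]
  ring

theorem pderiv_snd_planeMonomial (a b : ℕ) :
    MvPolynomial.pderiv (sndIndex hn) (planeMonomial hn a b) =
      b * planeMonomial hn a (b - 1) := by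
  have h := fstIndex_ne_sndIndex hn
  simp [planeMonomial, MvPolynomial.pderiv_X_of_ne h]
  ring

theorem pderiv_planeMonomial_eq_zero (a b : ℕ) {i : Fin n} (hi : 2 ≤ i.val) :
    MvPolynomial.pderiv i (planeMonomial hn a b) = 0 := by
  have h := ne_fstIndex_and_ne_sndIndex hn hi
  simp [planeMonomial, MvPolynomial.pderiv_X_of_ne h.1, MvPolynomial.pderiv_X_of_ne h.2]

theorem planeMonomial_dvd {a b a' b' : ℕ} (ha : a ≤ a') (hb : b ≤ b') :
    planeMonomial hn a b ∣ planeMonomial hn a' b' :=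
  mul_dvd_mul (pow_dvd_pow _ ha) (pow_dvd_pow _ hb)

/-- Reduction of `exists_weightRespecting_automorphism` to a statement on the plane curve
singularity for binomials in `x_1, x_2` plus squares of the other variables. -/
theorem exists_automorphism_of_binomial {w : Fin n → ℕ} (hw : ∀ i, 0 < w i) {d a b a' b' : ℕ}
    (f : ConvergentSeries n) {g : MvPowerSeries (Fin n) ℂ}
    (hg : g = ((planeMonomial hn a b + planeMonomial hn a' b' + squaresPolynomial n 2 :
      MvPolynomial (Fin n) ℂ) : MvPowerSeries (Fin n) ℂ))
    (hgd : g.IsWeightedHomogeneous w d)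
    (hf : VanishesBelow w (d + 1) ((f : MvPowerSeries (Fin n) ℂ) - g))
    (hJ : ∀ I : Ideal (MvPolynomial (Fin n) ℂ), ∀ u v : ℕ, 0 < u → 0 < v →
      a * u + b * v = d → a' * u + b' * v = d →
      a * planeMonomial hn (a - 1) b + a' * planeMonomial hn (a' - 1) b' ∈ I →
      b * planeMonomial hn a (b - 1) + b' * planeMonomial hn a' (b' - 1) ∈ I →
      ∀ i j : ℕ, d < i * u + j * v → planeMonomial hn i j ∈ I) :
    ∃ Ψ : ConvergentSeries n ≃ₐ[ℂ] ConvergentSeries n,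
      IsWeightRespecting w Ψ ∧ (Ψ f : MvPowerSeries (Fin n) ℂ) = g := by
  classical
  have hp : (planeMonomial hn a b + planeMonomial hn a' b' +
      squaresPolynomial n 2).IsWeightedHomogeneous w d := fun α hα => by
    by_contra h
    refine hα ?_
    rw [← MvPolynomial.coeff_coe, ← hg]
    exact hgd.coeff_eq_zero h
  -- Used to read the weight equations off homogeneity: both exponents occur with coefficient `1`,
  -- or `2` if they coincide, so neither monomial cancels.
  have hcoeff (i j : ℕ) : MvPolynomial.coeff (planeExponent hn i j) (planeMonomial hn a b +
      planeMonomial hn a' b' + squaresPolynomial n 2) =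
      (if a = i ∧ b = j then 1 else 0) + if a' = i ∧ b' = j then 1 else 0 := by
    rw [MvPolynomial.coeff_add, MvPolynomial.coeff_add, squaresPolynomial.coeff_eq_zero
      fun i hi => planeExponent_apply_eq_zero hn _ _ hi, add_zero, ← monomial_planeExponent,
      ← monomial_planeExponent, MvPolynomial.coeff_monomial, MvPolynomial.coeff_monomial]
    simp only [planeExponent_inj]
  have h₁ : a * w (fstIndex hn) + b * w (sndIndex hn) = d := by
    rw [← weight_planeExponent]
    refine hp ?_
    rw [hcoeff, if_pos ⟨rfl, rfl⟩]
    split_ifs <;> norm_num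
  have h₂ : a' * w (fstIndex hn) + b' * w (sndIndex hn) = d := by
    rw [← weight_planeExponent]
    refine hp ?_
    rw [hcoeff, if_pos (And.intro (Eq.refl a') (Eq.refl b'))]
    split_ifs <;> norm_num
  rw [hg] at hf ⊢
  refine exists_weightRespecting_automorphism hw hp (fun γ hγ => ?_) f hf
  by_cases h : ∃ i : Fin n, 2 ≤ i.val ∧ γ i ≠ 0
  · obtain ⟨i, hi, hi'⟩ := h
    refine monomial_mem_jacobian_add_squares (fun i hi => ?_) hi hi'
    rw [map_add, pderiv_planeMonomial_eq_zero hn _ _ hi, pderiv_planeMonomial_eq_zero hn _ _ hi,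
      add_zero]
  · push Not at h
    rw [eq_planeExponent hn h] at hγ ⊢
    rw [weight_planeExponent] at hγ
    rw [monomial_planeExponent]
    refine hJ _ _ _ (hw _) (hw _) h₁ h₂ ?_ ?_ _ _ hγ
    · rw [← pderiv_fst_planeMonomial, ← pderiv_fst_planeMonomial, ← map_add]
      exact span_pderiv_le_jacobian_add_squares {fstIndex hn} (by simp [fstIndex])
        (Ideal.subset_span ⟨_, rfl, rfl⟩)
    · rw [← pderiv_snd_planeMonomial, ← pderiv_snd_planeMonomial, ← map_add]
      exact span_pderiv_le_jacobian_add_squares {sndIndex hn} (by simp [sndIndex])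
        (Ideal.subset_span ⟨_, rfl, rfl⟩)

end

/-! ### The Jacobian condition for each type -/

/-- The ideal contains `x_1 ^ k`, while a power of `x_1` of weight above `d = (k + 1) w_1` has
exponent above `k + 1`. This type is treated apart from the binomials because `n = 1` is allowed. -/
theorem exists_automorphism_of_A {n k : ℕ} (hn : 1 ≤ n) {w : Fin n → ℕ} (hw : ∀ i, 0 < w i)
    {d : ℕ} (f : ConvergentSeries n) (hgd : (ADENormalForm.A k hn).IsWeightedHomogeneous w d)
    (hf : VanishesBelow w (d + 1) ((f : MvPowerSeries (Fin n) ℂ) - ADENormalForm.A k hn)) :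
    ∃ Ψ : ConvergentSeries n ≃ₐ[ℂ] ConvergentSeries n,
      IsWeightRespecting w Ψ ∧ (Ψ f : MvPowerSeries (Fin n) ℂ) = ADENormalForm.A k hn := by
  classical
  set x : Fin n := ⟨0, hn⟩ with hx
  have hne {i : Fin n} (hi : 1 ≤ i.val) : x ≠ i := by
    rintro rfl
    simp [hx] at hi
  have hg : ADENormalForm.A k hn = ((MvPolynomial.X x ^ (k + 1) + squaresPolynomial n 1 :
      MvPolynomial (Fin n) ℂ) : MvPowerSeries (Fin n) ℂ) := by
    rw [MvPolynomial.coe_add, MvPolynomial.coe_pow, MvPolynomial.coe_X, squaresPolynomial.coe,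
      ADENormalForm.A]
  have hp : (MvPolynomial.X x ^ (k + 1) + squaresPolynomial n 1 :
      MvPolynomial (Fin n) ℂ).IsWeightedHomogeneous w d := fun α hα => by
    by_contra h
    refine hα ?_
    rw [← MvPolynomial.coeff_coe, ← hg]
    exact hgd.coeff_eq_zero h
  have hd : (k + 1) * w x = d := by
    rw [← smul_eq_mul, ← Finsupp.weight_single]
    refine hp ?_
    rw [MvPolynomial.coeff_add, squaresPolynomial.coeff_eq_zero fun i hi => by simp [hne hi],
      MvPolynomial.X_pow_eq_monomial, MvPolynomial.coeff_monomial, if_pos rfl]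
    simp
  rw [hg] at hf ⊢
  refine exists_weightRespecting_automorphism hw hp (fun γ hγ => ?_) f hf
  by_cases h : ∃ i : Fin n, 1 ≤ i.val ∧ γ i ≠ 0
  · obtain ⟨i, hi, hi'⟩ := h
    refine monomial_mem_jacobian_add_squares (fun i hi => ?_) hi hi'
    rw [MvPolynomial.pderiv_pow, MvPolynomial.pderiv_X_of_ne (hne hi), mul_zero]
  · push Not at h
    have hγx : γ = Finsupp.single x (γ x) := by
      ext i
      by_cases hi : i = x
      · subst hi
        simp
      · rw [h i (by simp only [hx, Fin.ext_iff] at hi; omega), Finsupp.single_apply,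
          if_neg (Ne.symm hi)]
    rw [hγx] at hγ ⊢
    rw [Finsupp.weight_single, smul_eq_mul, ← hd] at hγ
    have hlt := lt_of_mul_lt_mul_right hγ (Nat.zero_le _)
    rw [← MvPolynomial.X_pow_eq_monomial]
    refine Ideal.mem_of_dvd _ (pow_dvd_pow _ (show k ≤ γ x by omega)) ?_
    refine Ideal.mem_of_natCast_mul_mem (Nat.succ_ne_zero k) ?_
    refine span_pderiv_le_jacobian_add_squares {x} (by simp [hx])
      (Ideal.subset_span ⟨x, rfl, ?_⟩)
    simp

/-- With `x = x_1`, `y = x_2`, the derivatives `y^2 + (k-1) x^(k-2)` and `2xy` put `xy`, `y^3` and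
`x^(k-1)` in the ideal. The remaining monomials are `y^j` with `j ≤ 2` and `x^i` with `i ≤ k - 2`,
of weight less than `d`. -/
theorem exists_automorphism_of_D {n k : ℕ} (hk : 4 ≤ k) (hn : 2 ≤ n) {w : Fin n → ℕ}
    (hw : ∀ i, 0 < w i) {d : ℕ} (f : ConvergentSeries n)
    (hgd : (ADENormalForm.D k hn).IsWeightedHomogeneous w d)
    (hf : VanishesBelow w (d + 1) ((f : MvPowerSeries (Fin n) ℂ) - ADENormalForm.D k hn)) :
    ∃ Ψ : ConvergentSeries n ≃ₐ[ℂ] ConvergentSeries n,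
      IsWeightRespecting w Ψ ∧ (Ψ f : MvPowerSeries (Fin n) ℂ) = ADENormalForm.D k hn := by
  obtain ⟨m, rfl⟩ := Nat.exists_eq_add_of_le' hk
  refine exists_automorphism_of_binomial hn hw (a := 1) (b := 2) (a' := m + 3) (b' := 0) f ?_
    hgd hf fun I u v hu hv h₁ h₂ hx hy i j hij => ?_
  · simp only [ADENormalForm.D, ADENormalForm.x₁, ADENormalForm.x₂, planeMonomial, fstIndex,
      sndIndex, MvPolynomial.coe_add, MvPolynomial.coe_mul, MvPolynomial.coe_pow,
      MvPolynomial.coe_X, squaresPolynomial.coe, show m + 4 - 2 = m + 2 by omega]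
    ring
  have hxy : planeMonomial hn 1 1 ∈ I := by
    refine Ideal.mem_of_natCast_mul_mem (m := 2) two_ne_zero ?_
    simpa using hy
  by_cases hi : i = 0
  · have hj : 3 ≤ j := by
      subst hi
      by_contra! hj
      have : j * v ≤ 2 * v := Nat.mul_le_mul_right _ (by omega)
      omega
    refine Ideal.mem_of_dvd _ (planeMonomial_dvd hn (Nat.zero_le i) hj) ?_
    have := I.sub_mem (I.mul_mem_left (MvPolynomial.X (sndIndex hn)) hx) (I.mul_mem_left
      (((m + 3 : ℕ) : MvPolynomial (Fin n) ℂ) * MvPolynomial.X (fstIndex hn) ^ (m + 1)) hxy)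
    convert this using 1
    simp only [planeMonomial]
    push_cast
    ring
  by_cases hj : j = 0
  · have hi : m + 3 ≤ i := by
      subst hj
      by_contra! hi
      have : i * u ≤ (m + 3) * u := Nat.mul_le_mul_right _ (by omega)
      omega
    refine Ideal.mem_of_dvd _ (planeMonomial_dvd hn hi (Nat.zero_le j)) ?_
    refine Ideal.mem_of_natCast_mul_mem (m := m + 3) (by omega) ?_
    have := I.sub_mem (I.mul_mem_left (MvPolynomial.X (fstIndex hn)) hx) (I.mul_mem_left
      (MvPolynomial.X (sndIndex hn)) hxy)
    convert this using 1
    simp only [planeMonomial, show m + 3 - 1 = m + 2 by omega]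
    push_cast
    ring
  exact Ideal.mem_of_dvd _ (planeMonomial_dvd hn (by omega) (by omega)) hxy

/-- Modulo `x^2` and `y^3` the heaviest monomial left is `x y^2`, of weight `d/3 + 2d/4 < d`. -/
theorem exists_automorphism_of_E₆ {n : ℕ} (hn : 2 ≤ n) {w : Fin n → ℕ}
    (hw : ∀ i, 0 < w i) {d : ℕ} (f : ConvergentSeries n)
    (hgd : (ADENormalForm.E₆ hn).IsWeightedHomogeneous w d)
    (hf : VanishesBelow w (d + 1) ((f : MvPowerSeries (Fin n) ℂ) - ADENormalForm.E₆ hn)) :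
    ∃ Ψ : ConvergentSeries n ≃ₐ[ℂ] ConvergentSeries n,
      IsWeightRespecting w Ψ ∧ (Ψ f : MvPowerSeries (Fin n) ℂ) = ADENormalForm.E₆ hn := by
  refine exists_automorphism_of_binomial hn hw (a := 3) (b := 0) (a' := 0) (b' := 4) f ?_
    hgd hf fun I u v hu hv h₁ h₂ hx hy i j hij => ?_
  · simp [ADENormalForm.E₆, ADENormalForm.x₁, ADENormalForm.x₂, planeMonomial, fstIndex,
      sndIndex, squaresPolynomial.coe]
  by_cases hi : 2 ≤ i
  · refine Ideal.mem_of_dvd _ (planeMonomial_dvd hn hi (Nat.zero_le j)) ?_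
    refine Ideal.mem_of_natCast_mul_mem (m := 3) three_ne_zero ?_
    simpa using hx
  · have hj : 3 ≤ j := by
      by_contra! hj
      have h₃ : i * u ≤ 1 * u := Nat.mul_le_mul_right _ (by omega)
      have h₄ : j * v ≤ 2 * v := Nat.mul_le_mul_right _ (by omega)
      omega
    refine Ideal.mem_of_dvd _ (planeMonomial_dvd hn (Nat.zero_le i) hj) ?_
    refine Ideal.mem_of_natCast_mul_mem (m := 4) four_ne_zero ?_
    simpa using hy

/-- The derivatives `3x^2 + y^3` and `3xy^2` put `xy^2`, `y^5` and `x^3` in the ideal. Here `x` and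
`y` have weights `d/3` and `2d/9`, so the heaviest monomials left, `y^4` and `x^2 y`, have weight
`8d/9`. -/
theorem exists_automorphism_of_E₇ {n : ℕ} (hn : 2 ≤ n) {w : Fin n → ℕ}
    (hw : ∀ i, 0 < w i) {d : ℕ} (f : ConvergentSeries n)
    (hgd : (ADENormalForm.E₇ hn).IsWeightedHomogeneous w d)
    (hf : VanishesBelow w (d + 1) ((f : MvPowerSeries (Fin n) ℂ) - ADENormalForm.E₇ hn)) :
    ∃ Ψ : ConvergentSeries n ≃ₐ[ℂ] ConvergentSeries n,
      IsWeightRespecting w Ψ ∧ (Ψ f : MvPowerSeries (Fin n) ℂ) = ADENormalForm.E₇ hn := by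
  refine exists_automorphism_of_binomial hn hw (a := 3) (b := 0) (a' := 1) (b' := 3) f ?_
    hgd hf fun I u v hu hv h₁ h₂ hx hy i j hij => ?_
  · simp only [ADENormalForm.E₇, ADENormalForm.x₁, ADENormalForm.x₂, planeMonomial, fstIndex,
      sndIndex, MvPolynomial.coe_add, MvPolynomial.coe_mul, MvPolynomial.coe_pow,
      MvPolynomial.coe_X, squaresPolynomial.coe]
    ring
  have hxy : planeMonomial hn 1 2 ∈ I := by
    refine Ideal.mem_of_natCast_mul_mem (m := 3) three_ne_zero ?_
    simpa using hy
  by_cases hi : i = 0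
  · have hj : 5 ≤ j := by
      subst hi
      by_contra! hj
      have : j * v ≤ 4 * v := Nat.mul_le_mul_right _ (by omega)
      omega
    refine Ideal.mem_of_dvd _ (planeMonomial_dvd hn (Nat.zero_le i) hj) ?_
    have := I.sub_mem (I.mul_mem_left (MvPolynomial.X (sndIndex hn) ^ 2) hx) (I.mul_mem_left
      (3 * MvPolynomial.X (fstIndex hn)) hxy)
    convert this using 1
    simp only [planeMonomial]
    push_cast
    ring
  by_cases hj : j ≤ 1
  · have hi : 3 ≤ i := by
      by_contra! hi
      have h₃ : i * u ≤ 2 * u := Nat.mul_le_mul_right _ (by omega)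
      have h₄ : j * v ≤ 1 * v := Nat.mul_le_mul_right _ hj
      omega
    refine Ideal.mem_of_dvd _ (planeMonomial_dvd hn hi (Nat.zero_le j)) ?_
    refine Ideal.mem_of_natCast_mul_mem (m := 3) three_ne_zero ?_
    have := I.sub_mem (I.mul_mem_left (MvPolynomial.X (fstIndex hn)) hx) (I.mul_mem_left
      (MvPolynomial.X (sndIndex hn)) hxy)
    convert this using 1
    simp only [planeMonomial]
    push_cast
    ring
  exact Ideal.mem_of_dvd _ (planeMonomial_dvd hn (by omega) (by omega)) hxy

/-- Modulo `x^2` and `y^4` the heaviest monomial left is `x y^3`, of weight `d/3 + 3d/5 < d`. -/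
theorem exists_automorphism_of_E₈ {n : ℕ} (hn : 2 ≤ n) {w : Fin n → ℕ}
    (hw : ∀ i, 0 < w i) {d : ℕ} (f : ConvergentSeries n)
    (hgd : (ADENormalForm.E₈ hn).IsWeightedHomogeneous w d)
    (hf : VanishesBelow w (d + 1) ((f : MvPowerSeries (Fin n) ℂ) - ADENormalForm.E₈ hn)) :
    ∃ Ψ : ConvergentSeries n ≃ₐ[ℂ] ConvergentSeries n,
      IsWeightRespecting w Ψ ∧ (Ψ f : MvPowerSeries (Fin n) ℂ) = ADENormalForm.E₈ hn := by
  refine exists_automorphism_of_binomial hn hw (a := 3) (b := 0) (a' := 0) (b' := 5) f ?_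
    hgd hf fun I u v hu hv h₁ h₂ hx hy i j hij => ?_
  · simp [ADENormalForm.E₈, ADENormalForm.x₁, ADENormalForm.x₂, planeMonomial, fstIndex,
      sndIndex, squaresPolynomial.coe]
  by_cases hi : 2 ≤ i
  · refine Ideal.mem_of_dvd _ (planeMonomial_dvd hn hi (Nat.zero_le j)) ?_
    refine Ideal.mem_of_natCast_mul_mem (m := 3) three_ne_zero ?_
    simpa using hx
  · have hj : 4 ≤ j := by
      by_contra! hj
      have h₃ : i * u ≤ 1 * u := Nat.mul_le_mul_right _ (by omega)
      have h₄ : j * v ≤ 3 * v := Nat.mul_le_mul_right _ (by omega)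
      omega
    refine Ideal.mem_of_dvd _ (planeMonomial_dvd hn (Nat.zero_le i) hj) ?_
    refine Ideal.mem_of_natCast_mul_mem (m := 5) (by omega) ?_
    simpa using hy

/-! ### Splitting off the part of least weight -/

theorem isWeightedHomogeneous_leastWeightPart {n : ℕ} (w : Fin n → ℕ)
    (f : MvPowerSeries (Fin n) ℂ) :
    (leastWeightPart w f).IsWeightedHomogeneous w (f.weightedOrder w).toNat :=
  MvPowerSeries.isWeightedHomogeneous_weightedHomogeneousComponent w f _

theorem vanishesBelow_sub_leastWeightPart {n : ℕ} (w : Fin n → ℕ) (f : MvPowerSeries (Fin n) ℂ) :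
    VanishesBelow w ((f.weightedOrder w).toNat + 1) (f - leastWeightPart w f) := fun α hα => by
  rw [map_sub, leastWeightPart, MvPowerSeries.coeff_weightedHomogeneousComponent]
  split_ifs with h
  · exact sub_self _
  · rw [sub_zero]
    refine MvPowerSeries.coeff_eq_zero_of_lt_weightedOrder w ?_
    -- Only `toNat ≤` the weighted order is needed, so `f = 0`, where `toNat` turns infinity into
    -- `0`, requires no separate case.
    exact lt_of_lt_of_le (by exact_mod_cast (by omega : Finsupp.weight w α <
      (f.weightedOrder w).toNat)) (ENat.natCast_toNat_le_self _)

theorem mainTheorem11 (n : ℕ) (w : Fin n → ℕ) (hw : ∀ i, 0 < w i)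
    (f : ConvergentSeries n)
    (hf : IsADENormalForm (leastWeightPart w (f : MvPowerSeries (Fin n) ℂ))) :
    ∃ Ψ : ConvergentSeries n ≃ₐ[ℂ] ConvergentSeries n,
      IsWeightRespecting w Ψ ∧
      (Ψ f : MvPowerSeries (Fin n) ℂ) = leastWeightPart w (f : MvPowerSeries (Fin n) ℂ) := by
  have h₁ := @isWeightedHomogeneous_leastWeightPart n w (f : MvPowerSeries (Fin n) ℂ)
  have h₂ := vanishesBelow_sub_leastWeightPart w (f : MvPowerSeries (Fin n) ℂ)
  obtain ⟨hn, k, -, h⟩ | ⟨hn, ⟨k, hk, h⟩ | h | h | h⟩ := hf <;> rw [h] at h₁ h₂ ⊢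
  · exact exists_automorphism_of_A hn hw f h₁ h₂
  · exact exists_automorphism_of_D hk hn hw f h₁ h₂
  · exact exists_automorphism_of_E₆ hn hw f h₁ h₂
  · exact exists_automorphism_of_E₇ hn hw f h₁ h₂
  · exact exists_automorphism_of_E₈ hn hw f h₁ h₂
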